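/- **Lecture hall graph.** For integers $t,i,j\ge 0$ with $j\le i$ put $v^t_{i,j}=(i,\,t+\tfrac{j}{i+1})$. An east step is a pair $(v^t_{i,j},v^t_{i+1,j})$; a south step is a pair $(v^t_{i,j},v^t_{i,j-1})$ with $j\ge1$, or $(v^{t+1}_{i,0},v^{t}_{i,i})$. For $n,k\ge0$ let $\mathrm{SE}_{n,k}$ be the set of paths from $(k,\infty)$ to $(n,0)$, i.e. sequences $(\dots,v_2,v_1,v_0)$ of such points with $v_0=(n,0)$ and $\lim_m v_m=(k,\infty)$, in which every $(v_{m+1},v_m)$ is an east or a south step. A weight system $w$ assigns a weight $w(t;i,j)$ to each east step $(v^t_{i,j},v^t_{i+1,j})$; the weight $w(p)$ of a path $p$ is the product of the weights of its east steps, and $h^w_{n,k}=\sum_{p\in \mathrm{SE}_{n,k}}w(p)$. The height of $w$ is the least $\ell$ such that $w(t;i,j)=0$ whenever $t\ge\ell$. If $w^{(1)}$ has finite height $\ell$, then $(w^{(1)}\sqcup w^{(2)})(t;i,j)$ is $w^{(1)}(t;i,j)$ for $t<\ell$ and $w^{(2)}(t-\ell;i,j)$ for $t\ge\ell$. **Askey–Wilson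 polynomials.** Write $(x;q)_n=\prod_{r=0}^{n-1}(1-xq^r)$, $(x_1,\dots,x_s;q)_n=\prod_r(x_r;q)_n$, and $$p_n(x;a,b,c,d|q)=\frac{(ab,ac,ad;q)_n}{2^na^n(abcdq^{n-1};q)_n}\sum_{k=0}^n\frac{(q^{-n},abcdq^{n-1};q)_k\,(ae^{i\theta},ae^{-i\theta};q)_k}{(ab,ac,ad,q;q)_k}\,q^k,\qquad x=\cos\theta,$$ where $(ae^{i\theta},ae^{-i\theta};q)_k$ stands for the polynomial $\prod_{r=0}^{k-1}(1-2aq^rx+a^2q^{2r})$. The mixed moments $\sigma^{AW}_{n,k}=\sigma^{AW}_{n,k}(a,b,c,d;q)$ are defined by $x^n=\sum_{k=0}^n\sigma^{AW}_{n,k}\,p_k(x;a,b,c,d|q)$, and $\sigma^{AW}_{n,k}=0$ for $k>n$. **Weight systems.** Let $$w^H(t;i,j)=\begin{cases}(q^j+q^{-j})/2 & t=0,\\ -q^{j-i}/2 & t=1,\\ -q^{i-j}/2 & t=2,\\ 0 & t\ge3,\end{cases}$$ and, for $t=8m+r$ with $0\le r\le7$, let $w^{AW,H}(t;i,j)=\frac12(abcdq^{2i})^m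 q^j\,u_r$, where $u_0=a$ if $m=0$, $u_0=-a^{-1}q^{-i}$ if $m\neq0$, $u_1=b$, $u_2=c$, $u_3=-abcq^i$, $u_4=d$, $u_5=-abdq^i$, $u_6=-acdq^i$, $u_7=a^2bcdq^{2i}$. Put $w^{AW}=w^H\sqcup w^{AW,H}$. **Theorem.** In each of the following two settings $w^H$ has height $3$, the polynomial $p_n(x;a,b,c,d|q)$ has degree $n$ for every $n$, so that the $\sigma^{AW}_{n,k}$ exist and are unique, and $$h^{w^{AW}}_{n,k}=\sigma^{AW}_{n,k}(a,b,c,d;q)\qquad\text{for all } n,k\ge0 .$$ 1. (Numerical parameters.) $a,b,c,d,q$ are elements of a complete normed field in which $2\ne0$ (for example $\mathbb R$ or $\mathbb C$), with $a\neq0$, $q\ne0$, $q^r\neq1$ for $r\ge1$, $abq^r,acq^r,adq^r\ne1$ for $r\ge0$ (so that $p_n$ is defined by the formula above), and $|abcdq^r|<1$ for all $r\ge0$. The sum defining $h^{w^{AW}}_{n,k}$ is summable, with sum $\sigma^{AW}_{n,k}$. 2. (Formal parameters.) $q\neq0$ is an element, not a root of unity, of a field $F$ in which $2\neq0$ (for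 example $F=\mathbb Q(q)$), and $a,b,c,d$ are independent variables; $p_n$ has coefficients in the fraction field of $F[[a,b,c,d]]$. All weights $w^{AW}(t;i,j)$ lie in $F[[a,b,c,d]]$, each monomial in $a,b,c,d$ occurs in $w^{AW}(p)$ for only finitely many $p\in \mathrm{SE}_{n,k}$, and the resulting formal power series $h^{w^{AW}}_{n,k}$ equals $\sigma^{AW}_{n,k}$. -/

import Mathlib

open Polynomial Filter

noncomputable section

namespace LectureHall

/-! ### The lecture hall graph -/

/-- The vertex `v^t_{i,j} = (i, t + j / (i + 1))` of the lecture hall graph, `0 ≤ j ≤ i`. -/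
structure Vertex where
  t : ℕ
  i : ℕ
  j : ℕ
  hj : j ≤ i

/-- The second coordinate of a vertex; the first coordinate is `v.i`. -/
def Vertex.y (v : Vertex) : ℚ := (v.t : ℚ) + (v.j : ℚ) / ((v.i : ℚ) + 1)

/-- East steps `(v^t_{i,j}, v^t_{i+1,j})`. -/
def IsEastStep (u v : Vertex) : Prop :=
  v.t = u.t ∧ v.i = u.i + 1 ∧ v.j = u.j

/-- South steps `(v^t_{i,j}, v^t_{i,j-1})` and `(v^t_{i,0}, v^{t-1}_{i,i})`. -/
def IsSouthStep (u v : Vertex) : Prop :=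
  v.i = u.i ∧ ((v.t = u.t ∧ u.j = v.j + 1) ∨ (u.t = v.t + 1 ∧ u.j = 0 ∧ v.j = v.i))

/-- The paths from `(k, ∞)` to `(n, 0)` made of south and east steps: sequences
`(…, v₂, v₁, v₀)` of vertices with `v₀ = (n, 0)` and `lim vₘ = (k, ∞)` in which every
`(vₘ₊₁, vₘ)` is an east or a south step. -/
structure SEPath (k n : ℕ) where
  vert : ℕ → Vertex
  vert_zero : vert 0 = ⟨0, n, 0, Nat.zero_le n⟩
  step : ∀ m, IsEastStep (vert (m + 1)) (vert m) ∨ IsSouthStep (vert (m + 1)) (vert m)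
  tendsto_fst : ∀ᶠ m in atTop, (vert m).i = k
  tendsto_snd : Tendsto (fun m => (vert m).y) atTop atTop

/-! ### Weight systems -/

/-- A weight system assigns the weight `w t i j` to the east step `(v^t_{i,j}, v^t_{i+1,j})`.
Only the values with `j ≤ i` matter. -/
abbrev WeightSystem (R : Type*) := ℕ → ℕ → ℕ → R

/-- The weight of a path: the product of the weights of its (finitely many) east steps. -/
def SEPath.weight {R : Type*} [CommRing R] {k n : ℕ} (p : SEPath k n) (w : WeightSystem R) : R :=
  ∏ᶠ (m : ℕ) (_ : IsEastStep (p.vert (m + 1)) (p.vert m)),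
    w (p.vert (m + 1)).t (p.vert (m + 1)).i (p.vert (m + 1)).j

/-- `h^w_{n,k}`, the sum of the weights of all paths from `(k, ∞)` to `(n, 0)`. -/
def h {R : Type*} [CommRing R] [TopologicalSpace R] (w : WeightSystem R) (n k : ℕ) : R :=
  ∑' p : SEPath k n, p.weight w

/-- The height of a weight system: the least `ℓ` with `w(t;i,j) = 0` for all `t ≥ ℓ`, and `⊤`
if there is none. -/
def height {R : Type*} [Zero R] (w : WeightSystem R) : ℕ∞ :=
  sInf {x : ℕ∞ | ∃ l : ℕ, x = l ∧ ∀ t i j : ℕ, l ≤ t → j ≤ i → w t i j = 0}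

/-- `w₁ ⊔ w₂`: the weight system `w₂` stacked on top of `w₁`, for `w₁` of finite height. -/
def stack {R : Type*} [Zero R] (w₁ w₂ : WeightSystem R) : WeightSystem R := fun t i j =>
  open Classical in
  if (t : ℕ∞) < height w₁ then w₁ t i j else w₂ (t - (height w₁).toNat) i j

/-! ### Askey–Wilson polynomials and mixed moments -/

/-- The `q`-shifted factorial `(x;q)_n`. -/
def qPoch {R : Type*} [CommRing R] (x q : R) (n : ℕ) : R :=
  ∏ r ∈ Finset.range n, (1 - x * q ^ r)

/-- `(a e^{iθ};q)_k (a e^{-iθ};q)_k` as a polynomial in `x = cos θ`. -/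
def qPochPair {K : Type*} [Field K] (a q : K) (k : ℕ) : K[X] :=
  ∏ r ∈ Finset.range k, (1 - C (2 * a * q ^ r) * X + C (a ^ 2 * q ^ (2 * r)))

/-- `qPochPair` at `x = (z + z⁻¹) / 2`, where `z` plays the role of `e^{iθ}`. -/
theorem qPochPair_eval {K : Type*} [Field K] (h2 : (2 : K) ≠ 0) (a q z : K) (hz : z ≠ 0)
    (k : ℕ) : (qPochPair a q k).eval ((z + z⁻¹) / 2) =
      qPoch (a * z) q k * qPoch (a * z⁻¹) q k := by
  unfold qPochPair qPoch
  rw [Polynomial.eval_prod, ← Finset.prod_mul_distrib]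
  refine Finset.prod_congr rfl fun r _ => ?_
  simp only [eval_add, eval_sub, eval_mul, eval_one, eval_C, eval_X]
  field_simp
  ring

/-- The monic Askey–Wilson polynomial
`(ab,ac,ad;q)_n / (2ⁿ aⁿ (abcdq^{n-1};q)_n)
  · ₄φ₃(q^{-n}, abcdq^{n-1}, a e^{iθ}, a e^{-iθ}; ab, ac, ad; q, q)`, `x = cos θ`;
the series terminates because `(q^{-n};q)_k = 0` for `k > n`. -/
def askeyWilson {K : Type*} [Field K] (a b c d q : K) (n : ℕ) : K[X] :=
  C (qPoch (a * b) q n * qPoch (a * c) q n * qPoch (a * d) q n /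
      (2 ^ n * a ^ n * qPoch (a * b * c * d * q ^ ((n : ℤ) - 1)) q n)) *
    ∑ k ∈ Finset.range (n + 1),
      C (qPoch (q ^ (-(n : ℤ))) q k * qPoch (a * b * c * d * q ^ ((n : ℤ) - 1)) q k /
          (qPoch (a * b) q k * qPoch (a * c) q k * qPoch (a * d) q k * qPoch q q k) * q ^ k) *
        qPochPair a q k

/-- `p` is a polynomial sequence with `deg pₙ = n`, and `σ` is the lower triangular array of its
mixed moments: `xⁿ = ∑_{k ≤ n} σ_{n,k} p_k(x)`. -/
def IsMixedMoments {K : Type*} [Field K] (p : ℕ → K[X]) (σ : ℕ → ℕ → K) : Prop :=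
  (∀ n, (p n).degree = n) ∧
  (∀ n, (X : K[X]) ^ n = ∑ k ∈ Finset.range (n + 1), C (σ n k) * p k) ∧
  ∀ n k, n < k → σ n k = 0

/-! ### The weight systems -/

/-- The weight system `w^H` for the continuous `q`-Hermite polynomials. -/
def wH {K : Type*} [Field K] (q : K) : WeightSystem K := fun t i j =>
  match t with
  | 0 => (q ^ (j : ℤ) + q ^ (-(j : ℤ))) / 2
  | 1 => -q ^ ((j : ℤ) - (i : ℤ)) / 2
  | 2 => -q ^ ((i : ℤ) - (j : ℤ)) / 2
  | _ => 0

/-- The weight system `w^{AW,H}`, with `t = 8 m + r`, `0 ≤ r < 8`. -/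
def wAWH {K : Type*} [Field K] (a b c d q : K) : WeightSystem K := fun t i j =>
  1 / 2 * (a * b * c * d * q ^ (2 * i)) ^ (t / 8) * q ^ j *
    match t % 8 with
    | 0 => if t = 0 then a else -a⁻¹ * q ^ (-(i : ℤ))
    | 1 => b
    | 2 => c
    | 3 => -(a * b * c) * q ^ i
    | 4 => d
    | 5 => -(a * b * d) * q ^ i
    | 6 => -(a * c * d) * q ^ i
    | _ => a ^ 2 * b * c * d * q ^ (2 * i)

/-- `w^{AW} = w^H ⊔ w^{AW,H}`. -/
def wAW {K : Type*} [Field K] (a b c d q : K) : WeightSystem K :=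
  stack (wH q) (wAWH a b c d q)

/-! ### Formal path sums -/

/-- `s` is the formal sum of the family `f` of power series: every monomial occurs in only
finitely many members of `f`, and coefficients add up. -/
def IsFormalSum {ι τ F : Type*} [CommRing F] (f : ι → MvPowerSeries τ F)
    (s : MvPowerSeries τ F) : Prop :=
  ∀ e : τ →₀ ℕ, {p : ι | MvPowerSeries.coeff e (f p) ≠ 0}.Finite ∧
    MvPowerSeries.coeff e s = ∑ᶠ p : ι, MvPowerSeries.coeff e (f p)

/-- The formal version of `h^w_{n,k} = x`: all weights `w(t;i,j)` are power series, and the sum of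
the weights of the paths from `(k, ∞)` to `(n, 0)` converges formally to the power series `x`. -/
def FormalPathSumEq {τ F : Type*} [Field F] (w : WeightSystem (FractionRing (MvPowerSeries τ F)))
    (n k : ℕ) (x : FractionRing (MvPowerSeries τ F)) : Prop :=
  ∃ (W : WeightSystem (MvPowerSeries τ F)) (s : MvPowerSeries τ F),
    (∀ t i j, j ≤ i →
      algebraMap (MvPowerSeries τ F) (FractionRing (MvPowerSeries τ F)) (W t i j) = w t i j) ∧
    IsFormalSum (fun p : SEPath k n => p.weight W) s ∧
    algebraMap (MvPowerSeries τ F) (FractionRing (MvPowerSeries τ F)) s = x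

/-- The parameters `a, b, c, d` as independent variables, inside the fraction field of
`F⟦a, b, c, d⟧`. -/
def param (F : Type*) [Field F] (r : Fin 4) : FractionRing (MvPowerSeries (Fin 4) F) :=
  algebraMap (MvPowerSeries (Fin 4) F) _ (MvPowerSeries.X r)

/-- A scalar `q` inside the fraction field of `F⟦a, b, c, d⟧`. -/
def scalar {F : Type*} [Field F] (q : F) : FractionRing (MvPowerSeries (Fin 4) F) :=
  algebraMap (MvPowerSeries (Fin 4) F) _ (MvPowerSeries.C q)

end LectureHall

end

open Polynomial Filter

noncomputable section

namespace LectureHall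

open Finset.HasAntidiagonal (antidiagonal)

/-! ### `q`-shifted factorials and `q`-binomial coefficients -/

section QSeries

variable {K : Type*} [Field K]

/-! Cut the graph at the integer heights. The slab between heights `t` and `t + 1` acts on sequences
of polynomials by a triangular matrix, so the theorem reduces to finding one polynomial sequence per
height, starting with `x ^ n` at height 0 and approaching the Askey–Wilson polynomials at infinity.
For slab weights `f i * q ^ j`, Pascal's rule gives the matrix with entries `[n choose k] * f k * ⋯
* f (n - 1)` (`isSlab_qTransform`), and products of such matrices are evaluated by terminating
`q`-sums (`qTransform_comp`).

The sequences are as follows. Newton interpolation at `(q^j + q^(-j))/2` turns `x ^ n` into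
multiples of `qPochPair 1 q`; two more slabs lead through the one-parameter polynomials with `a = 1`
to the continuous `q`-Hermite polynomials (`isChain_wH`). Their three-term recurrence does not
involve `a`, so the next slab may start from the actual `a` (`qHermite_param_indep`). The parameters
`a`, `b`, `c` then enter through `askeyWilson_connection`, which rests on the well-poised sum
`sum_wellPoised`.

Adding `d` needs the kernel `(d/2)^l (ab q^k, ac q^k, bc q^k; q)_l / (abcd q^(2k); q)_l`. The
`q`-Chu–Vandermonde sum splits off four slabs and leaves a kernel in which `(bc q^k; q)_l` is
replaced by `(ad q^k; q)_l` and a product of factors `-bc q^i`. Four further slabs exchange the two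
back (`isChain_block`). After eight levels the same kernel returns with `d/2` multiplied by `abcd
q^(2i)`, which explains the period of the weights. At height `7 + 8 m` the remaining matrix is thus
unitriangular, and its off-diagonal entries contain `m`-th powers of products of `abcd q^(2i)`.

Path sums truncated at a height obey the slab recursion (`IsChain.eq_sum_pathSum`). Comparing
coefficients gives an exact finite formula for the mixed moments: a truncated path sum plus terms
with an off-diagonal tail (`IsMixedMoments.eq_sum`). As `m` grows the tail disappears: in norm
(`tendsto_tailKernel`, with `summable_weight` for the path sum), or formally because it is divisible
by `b ^ m` (`isMultiple_tailKernel`). -/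

theorem qPoch_zero {R : Type*} [CommRing R] (x q : R) : qPoch x q 0 = 1 := by simp [qPoch]

theorem qPoch_succ {R : Type*} [CommRing R] (x q : R) (n : ℕ) :
    qPoch x q (n + 1) = qPoch x q n * (1 - x * q ^ n) := by
  simp [qPoch, Finset.prod_range_succ]

theorem qPoch_succ' {R : Type*} [CommRing R] (x q : R) (n : ℕ) :
    qPoch x q (n + 1) = (1 - x) * qPoch (x * q) q n := by
  simp only [qPoch, Finset.prod_range_succ', pow_zero, mul_one]
  rw [mul_comm]
  congr 1
  refine Finset.prod_congr rfl fun r _ => ?_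
  ring

theorem qPoch_add {R : Type*} [CommRing R] (x q : R) (m n : ℕ) :
    qPoch x q (m + n) = qPoch x q m * qPoch (x * q ^ m) q n := by
  simp only [qPoch, Finset.prod_range_add]
  congr 1
  refine Finset.prod_congr rfl fun r _ => ?_
  ring

theorem qPoch_zero_left {R : Type*} [CommRing R] (q : R) (n : ℕ) : qPoch 0 q n = 1 := by
  simp [qPoch]

theorem qPoch_ne_zero {x q : K} (h : ∀ r : ℕ, x * q ^ r ≠ 1) (n : ℕ) : qPoch x q n ≠ 0 :=
  Finset.prod_ne_zero_iff.2 fun r _ => sub_ne_zero.2 (h r).symm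

theorem qPoch_self_ne_zero {q : K} (hq : ∀ r : ℕ, 1 ≤ r → q ^ r ≠ 1) (n : ℕ) :
    qPoch q q n ≠ 0 :=
  qPoch_ne_zero (fun r => by rw [← pow_succ']; exact hq _ (by omega)) n

/-- The `q`-binomial coefficient `[k + l choose k]`. -/
def qBinom (q : K) (k l : ℕ) : K := qPoch q q (k + l) / (qPoch q q k * qPoch q q l)

theorem qBinom_comm (q : K) (k l : ℕ) : qBinom q k l = qBinom q l k := by
  simp [qBinom, add_comm, mul_comm]

theorem qBinom_zero_left {q : K} (hq : ∀ r : ℕ, 1 ≤ r → q ^ r ≠ 1) (l : ℕ) :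
    qBinom q 0 l = 1 := by
  simp [qBinom, qPoch_zero, div_self (qPoch_self_ne_zero hq l)]

theorem qBinom_zero_right {q : K} (hq : ∀ r : ℕ, 1 ≤ r → q ^ r ≠ 1) (k : ℕ) :
    qBinom q k 0 = 1 := by
  rw [qBinom_comm, qBinom_zero_left hq]

theorem qBinom_mul_qBinom {q : K} (hq : ∀ r : ℕ, 1 ≤ r → q ^ r ≠ 1) (k l m : ℕ) :
    qBinom q (k + l) m * qBinom q k l = qBinom q k (l + m) * qBinom q l m := by
  have h := qPoch_self_ne_zero hq
  have := h k; have := h l; have := h m; have := h (k + l); have := h (l + m)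
  simp only [qBinom, add_assoc]
  field_simp

theorem qBinom_succ_left {q : K} (hq : ∀ r : ℕ, 1 ≤ r → q ^ r ≠ 1) (k l : ℕ) :
    qBinom q (k + 1) l * (1 - q ^ (k + 1)) = (1 - q ^ (k + l + 1)) * qBinom q k l := by
  have h := qPoch_self_ne_zero hq
  have h1 := h k; have h2 := h l; have h3 := h (k + 1)
  have e : k + 1 + l = (k + l) + 1 := by ring
  rw [qPoch_succ] at h3
  have h4 := right_ne_zero_of_mul h3
  simp only [qBinom, e, qPoch_succ]
  rw [← pow_succ'] at *
  rw [← pow_succ'] at *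
  field_simp

theorem qBinom_succ_right {q : K} (hq : ∀ r : ℕ, 1 ≤ r → q ^ r ≠ 1) (k l : ℕ) :
    qBinom q k (l + 1) * (1 - q ^ (l + 1)) = (1 - q ^ (k + l + 1)) * qBinom q k l := by
  rw [qBinom_comm, qBinom_succ_left hq, qBinom_comm, add_comm l k]

theorem qBinom_succ_succ {q : K} (hq : ∀ r : ℕ, 1 ≤ r → q ^ r ≠ 1) (k l : ℕ) :
    qBinom q (k + 1) (l + 1) = q ^ (l + 1) * qBinom q k (l + 1) + qBinom q (k + 1) l := by
  have h1 := qBinom_succ_left hq k (l + 1)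
  have h2 := qBinom_succ_right hq (k + 1) l
  have h3 : (1 : K) - q ^ (k + l + 2) ≠ 0 := sub_ne_zero.2 (hq _ (by omega)).symm
  apply mul_left_cancel₀ h3
  have e1 : k + (l + 1) + 1 = k + l + 2 := by ring
  have e2 : k + 1 + l + 1 = k + l + 2 := by ring
  rw [e1] at h1
  rw [e2] at h2
  rw [mul_add, mul_left_comm, ← h1, ← h2]
  ring

/-! ### Pascal-type summation rules and terminating `q`-sums -/

variable {V : Type*} [AddCommGroup V] [Module K V]

/-- Summation by the two Pascal rules. -/
theorem sum_qBinom_succ {q : K} (hq : ∀ r : ℕ, 1 ≤ r → q ^ r ≠ 1) (n : ℕ) (Y : ℕ → ℕ → V) :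
    ∑ x ∈ antidiagonal (n + 1), qBinom q x.1 x.2 • Y x.1 x.2 =
      ∑ x ∈ antidiagonal n,
        qBinom q x.1 x.2 • (q ^ x.2 • Y (x.1 + 1) x.2 + Y x.1 (x.2 + 1)) := by
  rcases n with _ | n
  · simp [Finset.Nat.antidiagonal_succ, qBinom_zero_left hq, qBinom_zero_right hq, add_comm]
  simp only [smul_add, Finset.sum_add_distrib]
  rw [Finset.Nat.antidiagonal_succ_succ', Finset.Nat.sum_antidiagonal_succ' (n := n),
    Finset.Nat.sum_antidiagonal_succ (n := n)]
  simp only [Finset.sum_cons, Finset.sum_map, Function.Embedding.coe_prodMap,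
    Function.Embedding.coeFn_mk, Prod.map_fst, Prod.map_snd, Nat.succ_eq_add_one,
    qBinom_zero_left hq, qBinom_zero_right hq, qBinom_succ_succ hq, add_smul,
    Finset.sum_add_distrib, pow_zero, one_smul, smul_smul]
  simp only [mul_comm]
  abel

theorem sum_qBinom_succ' {q : K} (hq : ∀ r : ℕ, 1 ≤ r → q ^ r ≠ 1) (n : ℕ) (Y : ℕ → ℕ → V) :
    ∑ x ∈ antidiagonal (n + 1), qBinom q x.1 x.2 • Y x.1 x.2 =
      ∑ x ∈ antidiagonal n,
        qBinom q x.1 x.2 • (Y (x.1 + 1) x.2 + q ^ x.1 • Y x.1 (x.2 + 1)) := by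
  rw [← Finset.Nat.sum_antidiagonal_swap]
  simp only [Prod.fst_swap, Prod.snd_swap]
  simp only [qBinom_comm q (Prod.snd _)]
  rw [sum_qBinom_succ hq n fun k l => Y l k, ← Finset.Nat.sum_antidiagonal_swap]
  simp only [Prod.fst_swap, Prod.snd_swap]
  simp only [qBinom_comm q (Prod.snd _), add_comm]

/-- The factor `1 - q ^ l` kills the boundary term and lowers the `q`-binomial coefficient by one.
This is where the terms of index `n - 1` in the three-term recurrences come from. -/
theorem sum_qBinom_sub {q : K} (hq : ∀ r : ℕ, 1 ≤ r → q ^ r ≠ 1) (n : ℕ) (Y : ℕ → ℕ → V) :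
    ∑ x ∈ antidiagonal (n + 1), (qBinom q x.1 x.2 * (1 - q ^ x.2)) • Y x.1 x.2 =
      (1 - q ^ (n + 1)) • ∑ x ∈ antidiagonal n, qBinom q x.1 x.2 • Y x.1 (x.2 + 1) := by
  simp only [Finset.Nat.sum_antidiagonal_succ', Finset.smul_sum, pow_zero, sub_self, mul_zero,
    zero_smul, zero_add]
  refine Finset.sum_congr rfl fun x hx => ?_
  rw [qBinom_succ_right hq, Finset.HasAntidiagonal.mem_antidiagonal.1 hx, mul_smul]

theorem sum_qBinom_sub' {q : K} (hq : ∀ r : ℕ, 1 ≤ r → q ^ r ≠ 1) (n : ℕ) (Y : ℕ → ℕ → V) :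
    ∑ x ∈ antidiagonal (n + 1), (qBinom q x.1 x.2 * (1 - q ^ x.1)) • Y x.1 x.2 =
      (1 - q ^ (n + 1)) • ∑ x ∈ antidiagonal n, qBinom q x.1 x.2 • Y (x.1 + 1) x.2 := by
  simp only [Finset.Nat.sum_antidiagonal_succ, Finset.smul_sum, pow_zero, sub_self, mul_zero,
    zero_smul, zero_add]
  refine Finset.sum_congr rfl fun x hx => ?_
  rw [qBinom_succ_left hq, Finset.HasAntidiagonal.mem_antidiagonal.1 hx, mul_smul]

/-- The `q`-Chu–Vandermonde sum. -/
theorem qChuVandermonde {q : K} (hq : ∀ r : ℕ, 1 ≤ r → q ^ r ≠ 1) (A : K) (n : ℕ) (B : K)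
    (h : ∀ r : ℕ, A * B * q ^ r ≠ 1) :
    ∑ x ∈ antidiagonal n, qBinom q x.1 x.2 *
      ((∏ i ∈ Finset.range x.1, -(B * q ^ i)) * qPoch A q x.1 / qPoch (A * B) q x.1) =
      qPoch B q n / qPoch (A * B) q n := by
  induction n generalizing B with
  | zero => simp [qPoch_zero, qBinom_zero_left hq]
  | succ n ih =>
    have h' : ∀ r : ℕ, A * (B * q) * q ^ r ≠ 1 := fun r => by
      have := h (r + 1)
      rwa [pow_succ', ← mul_assoc, mul_assoc A] at this
    have h1 : 1 - A * B ≠ 0 := sub_ne_zero.2 (by simpa using (h 0).symm)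
    -- For a summand `Y j`, Pascal's rule produces `Y (j + 1) + q ^ j * Y j`, which is `(1 - B) / (1
    -- - A * B)` times the summand with `B * q` in place of `B`.
    have e := sum_qBinom_succ' hq n fun j _ : ℕ =>
      (∏ i ∈ Finset.range j, -(B * q ^ i)) * qPoch A q j / qPoch (A * B) q j
    simp only [smul_eq_mul] at e
    rw [e, qPoch_succ' B, qPoch_succ' (A * B), mul_div_mul_comm, mul_assoc A, ← ih _ h',
      Finset.mul_sum]
    refine Finset.sum_congr rfl fun x _ => ?_
    have h2 := qPoch_ne_zero h x.1
    have h3 := qPoch_ne_zero h (x.1 + 1)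
    have h4 := qPoch_ne_zero h' x.1
    have h5 : 1 - A * B * q ^ x.1 ≠ 0 := sub_ne_zero.2 (h _).symm
    have e1 : qPoch (A * B) q x.1 * (1 - A * B * q ^ x.1) =
        (1 - A * B) * qPoch (A * (B * q)) q x.1 := by
      rw [← qPoch_succ, qPoch_succ', mul_assoc A]
    have e2 : ∏ i ∈ Finset.range x.1, -(B * q * q ^ i) =
        (∏ i ∈ Finset.range x.1, -(B * q ^ i)) * q ^ x.1 := by
      rw [← Finset.card_range x.1, ← Finset.prod_const, Finset.card_range,
        ← Finset.prod_mul_distrib]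
      exact Finset.prod_congr rfl fun i _ => by ring
    rw [mul_left_comm]
    congr 1
    have e3 : qPoch (A * (B * q)) q x.1 =
        qPoch (A * B) q x.1 * (1 - A * B * q ^ x.1) / (1 - A * B) := by
      rw [e1]; field_simp
    rw [e2, Finset.prod_range_succ, qPoch_succ, qPoch_succ, e3]
    clear * - h1 h2 h5
    generalize hz : 1 - A * B * q ^ x.1 = z at *
    generalize 1 - A * B = v at *
    field_simp
    rw [← hz]
    ring

theorem qBinomialTheorem {q : K} (hq : ∀ r : ℕ, 1 ≤ r → q ^ r ≠ 1) (n : ℕ) (B : K) :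
    ∑ x ∈ antidiagonal n, qBinom q x.1 x.2 *
      (∏ i ∈ Finset.range x.1, -(B * q ^ i)) = qPoch B q n := by
  simpa [qPoch_zero_left] using qChuVandermonde hq 0 n B (by simp)

/-- The `q`-binomial theorem at `B = 1`, where the product contains the factor `1 - 1`. It serves to
invert triangular matrices. -/
theorem sum_qBinom_alternating {q : K} (hq : ∀ r : ℕ, 1 ≤ r → q ^ r ≠ 1) (n : ℕ) :
    ∑ x ∈ antidiagonal n, qBinom q x.1 x.2 *
      (∏ i ∈ Finset.range x.1, -q ^ i) = if n = 0 then 1 else 0 := by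
  have := qBinomialTheorem hq n 1
  simp only [one_mul] at this
  rw [this]
  rcases n with _ | n
  · simp [qPoch_zero]
  · simp [qPoch_succ']

/-- The inverse of `q` is harmless: for `n = 0` the product is empty, and otherwise all exponents of
`q` are nonnegative. -/
theorem qPoch_shift_ne_zero {x q : K} (hq0 : q ≠ 0) (h : ∀ r : ℕ, x * q ^ r ≠ 1) (n : ℕ) :
    qPoch (x * q ^ n * q⁻¹) q n ≠ 0 := by
  rcases n with _ | n
  · simp [qPoch_zero]
  · refine qPoch_ne_zero (fun r => ?_) _
    have := h (n + r)
    rw [pow_succ, ← mul_assoc, mul_assoc _ q, mul_inv_cancel₀ hq0, mul_one, mul_assoc, ← pow_add]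
    exact this

/-- The terminating very-well-poised sum behind the connection formula for Askey–Wilson
polynomials. -/
theorem sum_wellPoised {q : K} (hq0 : q ≠ 0) (hq : ∀ r : ℕ, 1 ≤ r → q ^ r ≠ 1) (n : ℕ)
    (α β : K) (h : ∀ r : ℕ, α * β * q ^ r ≠ 1) :
    ∑ x ∈ antidiagonal n, qBinom q x.1 x.2 *
      (α ^ x.2 * qPoch (β * q ^ x.1) q x.2 * qPoch α q x.1 /
        (qPoch (α * β * q ^ x.1 * q⁻¹) q x.1 * qPoch (α * β * q ^ (2 * x.1)) q x.2)) = 1 := by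
  induction n generalizing α β with
  | zero => simp [qPoch_zero, qBinom_zero_left hq]
  | succ n ih =>
    have h' : ∀ r : ℕ, α * q * (β * q) * q ^ r ≠ 1 := fun r => by
      have := h (r + 2)
      intro h0
      apply this
      rw [← h0]
      ring
    have hn : 1 - α * β * q ^ n ≠ 0 := sub_ne_zero.2 (h n).symm
    apply mul_left_cancel₀ hn
    set Y : ℕ → ℕ → K := fun l m => α ^ m * qPoch (β * q ^ l) q m * qPoch α q l /
        (qPoch (α * β * q ^ l * q⁻¹) q l * qPoch (α * β * q ^ (2 * l)) q m) with hY
    set Y' : ℕ → ℕ → K := fun l m => (α * q) ^ m * qPoch (β * q * q ^ l) q m *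
        qPoch (α * q) q l / (qPoch (α * q * (β * q) * q ^ l * q⁻¹) q l *
          qPoch (α * q * (β * q) * q ^ (2 * l)) q m) with hY'
    have i1 : ∑ x ∈ antidiagonal n, qBinom q x.1 x.2 * Y x.1 x.2 = 1 := ih α β h
    have i2 : ∑ x ∈ antidiagonal n, qBinom q x.1 x.2 * Y' x.1 x.2 = 1 := ih _ _ h'
    have e1 := sum_qBinom_succ hq n Y
    have e2 := sum_qBinom_succ' hq n Y
    simp only [smul_eq_mul] at e1 e2
    change _ * ∑ x ∈ antidiagonal (n + 1), qBinom q x.1 x.2 * Y x.1 x.2 = _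
    rw [sub_mul, one_mul, e1, ← e1, e2, ← e2, mul_one]
    -- The first Pascal rule minus `α * β * q ^ n` times the second: the coefficients of `Y l (m +
    -- 1)` and `Y (l + 1) m` become `1 - α * β * q ^ (2 * l + m)` and `q ^ m * (1 - α * β * q ^ l)`,
    -- which cancel denominators and leave the sums for `(α, β)` and `(α * q, β * q)`. Both are 1 by
    -- induction.
    have key : ∑ x ∈ antidiagonal (n + 1), qBinom q x.1 x.2 * Y x.1 x.2 -
        α * β * q ^ n * ∑ x ∈ antidiagonal (n + 1), qBinom q x.1 x.2 * Y x.1 x.2 =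
        α * (1 - β * q ^ n) * (∑ x ∈ antidiagonal n, qBinom q x.1 x.2 * Y x.1 x.2) +
        (1 - α) * ∑ x ∈ antidiagonal n, qBinom q x.1 x.2 * Y' x.1 x.2 := by
      nth_rewrite 1 [e1]
      rw [e2]
      simp only [Finset.mul_sum]
      rw [← Finset.sum_sub_distrib, ← Finset.sum_add_distrib]
      refine Finset.sum_congr rfl fun x hx => ?_
      obtain ⟨l, m⟩ := x
      obtain rfl : l + m = n := Finset.HasAntidiagonal.mem_antidiagonal.1 hx
      dsimp only
      have a1 : (1 - α * β * q ^ (2 * l + m)) * Y l (m + 1) =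
          α * (1 - β * q ^ (l + m)) * Y l m := by
        have n1 := qPoch_shift_ne_zero hq0 h l
        have n2 : qPoch (α * β * q ^ (2 * l)) q m ≠ 0 :=
          qPoch_ne_zero (fun r => by rw [mul_assoc, ← pow_add]; exact h _) m
        have n3 : 1 - α * β * q ^ (2 * l + m) ≠ 0 := sub_ne_zero.2 (h _).symm
        have s1 : α * β * q ^ (2 * l) * q ^ m = α * β * q ^ (2 * l + m) := by ring
        have s2 : β * q ^ l * q ^ m = β * q ^ (l + m) := by ring
        simp only [hY, qPoch_succ, s1, s2]
        field_simp
        ring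
      have a2 : q ^ m * (1 - α * β * q ^ l) * Y (l + 1) m = (1 - α) * Y' l m := by
        have n3 : 1 - α * β * q ^ l ≠ 0 := sub_ne_zero.2 (h _).symm
        have s1 : α * β * q ^ (l + 1) * q⁻¹ = α * β * q ^ l := by
          rw [pow_succ]; field_simp
        have s2 : α * q * (β * q) * q ^ l * q⁻¹ = α * β * q ^ l * q := by
          field_simp
        have s3 : α * q * (β * q) * q ^ (2 * l) = α * β * q ^ (2 * (l + 1)) := by ring
        have s4 : β * q * q ^ l = β * q ^ (l + 1) := by ring
        have n1 : qPoch (α * β * q ^ l * q) q l ≠ 0 :=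
          qPoch_ne_zero (fun r => by
            have := h (l + 1 + r)
            rwa [pow_add, pow_succ, ← mul_assoc, ← mul_assoc] at this) l
        have n2 : qPoch (α * β * q ^ (2 * (l + 1))) q m ≠ 0 :=
          qPoch_ne_zero (fun r => by rw [mul_assoc, ← pow_add]; exact h _) m
        simp only [hY, hY', s1, s2, s3, s4, qPoch_succ' _ _ l]
        field_simp
        ring
      linear_combination qBinom q l m * a1 + qBinom q l m * a2
    rw [key, i1, i2]
    ring

end QSeries

/-! ### Triangular transformations of sequences -/

section Transform

variable {K : Type*} [Field K] {V : Type*} [AddCommGroup V] [Module K V]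

/-- The product `f k * f (k + 1) * ⋯ * f (k + l - 1)`. -/
def risingProd {R : Type*} [CommRing R] (f : ℕ → R) (k l : ℕ) : R :=
  ∏ i ∈ Finset.range l, f (k + i)

theorem risingProd_add {R : Type*} [CommRing R] (f : ℕ → R) (k l m : ℕ) :
    risingProd f k (l + m) = risingProd f k l * risingProd f (k + l) m := by
  simp only [risingProd, Finset.prod_range_add, add_assoc]

theorem risingProd_succ {R : Type*} [CommRing R] (f : ℕ → R) (k l : ℕ) :
    risingProd f k (l + 1) = risingProd f k l * f (k + l) := by
  simp only [risingProd, Finset.prod_range_succ]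

theorem risingProd_mul {R : Type*} [CommRing R] (f g : ℕ → R) (k l : ℕ) :
    risingProd (fun i => f i * g i) k l = risingProd f k l * risingProd g k l := by
  simp only [risingProd, Finset.prod_mul_distrib]

theorem risingProd_const {R : Type*} [CommRing R] (x : R) (k l : ℕ) :
    risingProd (fun _ => x) k l = x ^ l := by
  simp [risingProd]

/-- The transformation of sequences with lower triangular matrix `[n choose k] * e k (n - k)`. -/
def qTransform (q : K) (e : ℕ → ℕ → K) (S : ℕ → V) (n : ℕ) : V :=
  ∑ x ∈ antidiagonal n, (qBinom q x.1 x.2 * e x.1 x.2) • S x.1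

theorem sum_antidiagonal_assoc {M : Type*} [AddCommMonoid M] (n : ℕ) (f : ℕ → ℕ → ℕ → M) :
    ∑ x ∈ antidiagonal n, ∑ y ∈ antidiagonal x.1, f y.1 y.2 x.2 =
      ∑ x ∈ antidiagonal n, ∑ y ∈ antidiagonal x.2, f x.1 y.1 y.2 := by
  simp only [Finset.sum_sigma']
  refine Finset.sum_nbij' (fun z ↦ ⟨(z.2.1, z.2.2 + z.1.2), (z.2.2, z.1.2)⟩)
    (fun z ↦ ⟨(z.1.1 + z.2.1, z.2.2), (z.1.1, z.2.1)⟩) ?_ ?_ ?_ ?_ ?_ <;>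
  rintro ⟨⟨i, j⟩, ⟨k, l⟩⟩ hz <;>
  simp only [Finset.mem_sigma, Finset.HasAntidiagonal.mem_antidiagonal] at hz ⊢
  · obtain ⟨rfl, rfl⟩ := hz
    exact ⟨(add_assoc _ _ _).symm, trivial⟩
  · obtain ⟨rfl, rfl⟩ := hz
    exact ⟨add_assoc _ _ _, trivial⟩
  · obtain ⟨-, rfl⟩ := hz
    rfl
  · obtain ⟨-, rfl⟩ := hz
    rfl

/-- The trinomial identity `qBinom_mul_qBinom` pulls the outer coefficient out of the matrix
product, so a product of kernels reduces to a single `q`-binomial sum for each starting index `k`.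
-/
theorem qTransform_comp {q : K} (hq : ∀ r : ℕ, 1 ≤ r → q ^ r ≠ 1) {e₁ e₂ e₃ : ℕ → ℕ → K}
    (h : ∀ k n, ∑ x ∈ antidiagonal n, qBinom q x.1 x.2 * (e₁ (k + x.1) x.2 * e₂ k x.1) = e₃ k n)
    (S : ℕ → V) : qTransform q e₁ (qTransform q e₂ S) = qTransform q e₃ S := by
  funext n
  simp only [qTransform, Finset.smul_sum, smul_smul]
  have := sum_antidiagonal_assoc n fun k l m =>
    (qBinom q (k + l) m * e₁ (k + l) m * (qBinom q k l * e₂ k l)) • S k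
  refine Eq.trans (Finset.sum_congr rfl fun x _ => Finset.sum_congr rfl fun y hy => ?_)
    (this.trans (Finset.sum_congr rfl fun x hx => ?_))
  · rw [Finset.HasAntidiagonal.mem_antidiagonal.1 hy]
  · rw [← h, ← Finset.sum_smul, Finset.mul_sum]
    congr 1
    refine Finset.sum_congr rfl fun y hy => ?_
    rw [← Finset.HasAntidiagonal.mem_antidiagonal.1 hy]
    linear_combination e₁ (x.1 + y.1) y.2 * e₂ x.1 y.1 * qBinom_mul_qBinom hq x.1 y.1 y.2

theorem qTransform_diag {q : K} (hq : ∀ r : ℕ, 1 ≤ r → q ^ r ≠ 1) (c : ℕ → K) (S : ℕ → V) :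
    qTransform q (fun k n => if n = 0 then c k else 0) S = fun n => c n • S n := by
  funext n
  rw [qTransform, Finset.sum_eq_single (n, 0)]
  · simp [qBinom_zero_right hq]
  · rintro ⟨k, l⟩ hx hne
    have := Finset.HasAntidiagonal.mem_antidiagonal.1 hx
    have : l ≠ 0 := fun h0 => hne (by simp_all)
    simp [this]
  · simp

/-- Two successive levels of a weight system whose ratio is `-B q ^ i`. -/
theorem qTransform_comp_cocycle {q : K} (hq : ∀ r : ℕ, 1 ≤ r → q ^ r ≠ 1) {u : ℕ → ℕ → K}
    (hu : ∀ k l m, u k (l + m) = u k l * u (k + l) m) (B D : K)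
    (h : ∀ r : ℕ, B * D * q ^ r ≠ 1) (S : ℕ → V) :
    qTransform q u (qTransform q (fun k l => u k l * risingProd (fun i => -(B * q ^ i)) k l *
        (qPoch (D * q ^ k) q l / qPoch (B * D * q ^ (2 * k)) q l)) S) =
      qTransform q (fun k l => u k l * (qPoch (B * q ^ k) q l / qPoch (B * D * q ^ (2 * k)) q l))
        S := by
  refine qTransform_comp hq (fun k n => ?_) S
  have e : D * q ^ k * (B * q ^ k) = B * D * q ^ (2 * k) := by ring
  have hcv := qChuVandermonde hq (D * q ^ k) n (B * q ^ k) (fun r => by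
    rw [e, mul_assoc, ← pow_add]; exact h _)
  rw [e] at hcv
  rw [← hcv, Finset.mul_sum]
  refine Finset.sum_congr rfl fun x hx => ?_
  rw [← Finset.HasAntidiagonal.mem_antidiagonal.1 hx, hu]
  simp only [risingProd, pow_add, ← mul_assoc]
  ring

/-- The case `D = 0`: a factor `(B q^k; q)_l` in a kernel costs exactly one additional slab. -/
theorem qTransform_comp_cocycle' {q : K} (hq : ∀ r : ℕ, 1 ≤ r → q ^ r ≠ 1) {u : ℕ → ℕ → K}
    (hu : ∀ k l m, u k (l + m) = u k l * u (k + l) m) (B : K) (S : ℕ → V) :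
    qTransform q u (qTransform q (fun k l => u k l * risingProd (fun i => -(B * q ^ i)) k l) S) =
      qTransform q (fun k l => u k l * qPoch (B * q ^ k) q l) S := by
  simpa [qPoch_zero_left] using qTransform_comp_cocycle hq hu B 0 (by simp) S

/-! ### Slabs of the lecture hall graph -/

/-- The sequence `R` at the bottom of a slab with weights `w` arises from the sequence `S` at its
top: there are values on the vertices of the slab that satisfy the path recursion. -/
def IsSlab (w : ℕ → ℕ → K) (R S : ℕ → V) : Prop :=
  ∃ P : ℕ → ℕ → V, (∀ n, P n 0 = R n) ∧ (∀ n, P n n = S n) ∧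
    ∀ n j, j ≤ n → P (n + 1) j = P (n + 1) (j + 1) + w n j • P n j

/-- The sequence `R` at level `s` arises from the sequence `S` at level `t`. -/
inductive IsChain (w : WeightSystem K) : ℕ → ℕ → (ℕ → V) → (ℕ → V) → Prop
  | refl (t : ℕ) (R : ℕ → V) : IsChain w t t R R
  | cons {s t : ℕ} {R S U : ℕ → V} : IsSlab (w s) R S → IsChain w (s + 1) t S U →
      IsChain w s t R U

theorem IsChain.trans {w : WeightSystem K} {s t u : ℕ} {R S U : ℕ → V} (h : IsChain w s t R S)
    (h' : IsChain w t u S U) : IsChain w s u R U := by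
  induction h with
  | refl => exact h'
  | cons h1 _ ih => exact .cons h1 (ih h')

/-- Inside the slab, the value at `(n, j)` is the same transform with indices shifted by `j` and an
extra `q ^ j` in each weight; the slab recursion is then the first Pascal rule. -/
theorem isSlab_qTransform {q : K} (hq : ∀ r : ℕ, 1 ≤ r → q ^ r ≠ 1) {w : ℕ → ℕ → K} (f : ℕ → K)
    (hw : ∀ i j, w i j = f i * q ^ j) (S : ℕ → V) :
    IsSlab w (qTransform q (risingProd f) S) S := by
  refine ⟨fun n j => ∑ x ∈ antidiagonal (n - j),
    qBinom q x.1 x.2 • ((q ^ j) ^ x.2 * risingProd f (j + x.1) x.2) • S (j + x.1),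
    fun n => ?_, fun n => ?_, fun n j hj => ?_⟩
  · simp [qTransform, mul_smul]
  · simp [qBinom_zero_left hq, risingProd]
  · obtain ⟨m, rfl⟩ := Nat.exists_eq_add_of_le hj
    have e1 : j + m + 1 - j = m + 1 := by omega
    have e2 : j + m + 1 - (j + 1) = m := by omega
    have e3 : j + m - j = m := by omega
    dsimp only
    rw [e1, e2, e3, sum_qBinom_succ hq m fun k l =>
      ((q ^ j) ^ l * risingProd f (j + k) l) • S (j + k), Finset.smul_sum,
      ← Finset.sum_add_distrib]
    refine Finset.sum_congr rfl fun x hx => ?_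
    rw [smul_add, hw, ← Finset.HasAntidiagonal.mem_antidiagonal.1 hx, risingProd_succ,
      pow_succ q j, mul_pow, add_right_comm j 1, add_assoc j]
    simp only [smul_smul]
    congr 2
    · ring_nf
    · ring

/-- As before with the second Pascal rule: weights in `q ^ (i - j)` give a kernel depending only on
the distance `l`. -/
theorem isSlab_qTransform_inv {q : K} (hq : ∀ r : ℕ, 1 ≤ r → q ^ r ≠ 1)
    {w : ℕ → ℕ → K} (c : K)
    (hw : ∀ i j, j ≤ i → w i j = c * q ^ (i - j)) (S : ℕ → V) :
    IsSlab w (qTransform q (fun _ l => ∏ i ∈ Finset.range l, (c * q ^ i)) S) S := by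
  refine ⟨fun n j => ∑ x ∈ antidiagonal (n - j),
    qBinom q x.1 x.2 • (∏ i ∈ Finset.range x.2, (c * q ^ i)) • S (j + x.1),
    fun n => ?_, fun n => ?_, fun n j hj => ?_⟩
  · simp [qTransform, mul_smul]
  · simp [qBinom_zero_left hq]
  · rw [hw _ _ hj]
    obtain ⟨m, rfl⟩ := Nat.exists_eq_add_of_le hj
    have e1 : j + m + 1 - j = m + 1 := by omega
    have e2 : j + m + 1 - (j + 1) = m := by omega
    have e3 : j + m - j = m := by omega
    dsimp only
    rw [e1, e2, e3, sum_qBinom_succ' hq m fun k l =>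
      (∏ i ∈ Finset.range l, (c * q ^ i)) • S (j + k), Finset.smul_sum,
      ← Finset.sum_add_distrib]
    refine Finset.sum_congr rfl fun x hx => ?_
    rw [smul_add, ← Finset.HasAntidiagonal.mem_antidiagonal.1 hx, Finset.prod_range_succ,
      add_right_comm j 1, add_assoc j]
    simp only [smul_smul]
    congr 2
    ring

/-- Four levels with weights `f`, `-A q ^ i f`, `-C q ^ i f`, `A C q ^ (2 i) f`. -/
theorem isChain_four {q : K} (hq : ∀ r : ℕ, 1 ≤ r → q ^ r ≠ 1) {w : WeightSystem K} {t : ℕ}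
    (f : ℕ → K) (A B C D : K) (h : ∀ r : ℕ, B * D * q ^ r ≠ 1)
    (h0 : ∀ i j, w t i j = f i * q ^ j)
    (h1 : ∀ i j, w (t + 1) i j = f i * -(A * q ^ i) * q ^ j)
    (h2 : ∀ i j, w (t + 2) i j = f i * -(C * q ^ i) * q ^ j)
    (h3 : ∀ i j, w (t + 3) i j = f i * -(C * q ^ i) * -(A * q ^ i) * q ^ j) (S : ℕ → V) :
    IsChain w t (t + 4)
      (qTransform q (fun k l => risingProd f k l * qPoch (A * q ^ k) q l *
        qPoch (C * q ^ k) q l * (qPoch (B * q ^ k) q l / qPoch (B * D * q ^ (2 * k)) q l)) S)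
      (qTransform q (fun k l => risingProd f k l * qPoch (A * q ^ k) q l *
        qPoch (C * q ^ k) q l * risingProd (fun i => -(B * q ^ i)) k l *
        (qPoch (D * q ^ k) q l / qPoch (B * D * q ^ (2 * k)) q l)) S) := by
  have hp : ∀ (A : K) (k l m : ℕ), qPoch (A * q ^ k) q (l + m) =
      qPoch (A * q ^ k) q l * qPoch (A * q ^ (k + l)) q m := fun A k l m => by
    rw [qPoch_add, pow_add, mul_assoc]
  set S' := qTransform q (fun k l => risingProd f k l * qPoch (A * q ^ k) q l *
        qPoch (C * q ^ k) q l * risingProd (fun i => -(B * q ^ i)) k l *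
        (qPoch (D * q ^ k) q l / qPoch (B * D * q ^ (2 * k)) q l)) S with hS'
  -- `c4` separates the quotient with `B` and `D` from the multiplicative part. `c3` then removes
  -- the factor with `C`, and `c1`, `c2` remove the factor with `A` from the two resulting kernels,
  -- which leaves four slabs.
  have c4 := qTransform_comp_cocycle hq (u := fun k l => risingProd f k l * qPoch (A * q ^ k) q l *
    qPoch (C * q ^ k) q l) (fun k l m => by rw [risingProd_add, hp, hp]; ring) B D h S
  rw [← hS'] at c4
  have c3 := qTransform_comp_cocycle' hq (u := fun k l => risingProd f k l * qPoch (A * q ^ k) q l)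
    (fun k l m => by rw [risingProd_add, hp]; ring) C S'
  have c2 := qTransform_comp_cocycle' hq (u := risingProd fun i => f i * -(C * q ^ i))
    (risingProd_add _) A S'
  have c1 := qTransform_comp_cocycle' hq (u := risingProd f) (risingProd_add _) A
    (qTransform q (risingProd fun i => f i * -(C * q ^ i))
      (qTransform q (risingProd fun i => f i * -(C * q ^ i) * -(A * q ^ i)) S'))
  have m2 : (fun k l => risingProd (fun i => f i * -(C * q ^ i)) k l *
      risingProd (fun i => -(A * q ^ i)) k l) =
      risingProd (fun i => f i * -(C * q ^ i) * -(A * q ^ i)) := by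
    funext k l; rw [← risingProd_mul]
  have m1 : (fun k l => risingProd f k l * risingProd (fun i => -(A * q ^ i)) k l) =
      risingProd (fun i => f i * -(A * q ^ i)) := by
    funext k l; rw [← risingProd_mul]
  have m3 : (fun k l => risingProd (fun i => f i * -(C * q ^ i)) k l * qPoch (A * q ^ k) q l) =
      fun k l => risingProd f k l * qPoch (A * q ^ k) q l *
        risingProd (fun i => -(C * q ^ i)) k l := by
    funext k l; rw [risingProd_mul]; ring
  rw [m2, m3] at c2
  rw [m1] at c1
  rw [← c4, ← c3, ← c2, ← c1]
  exact .cons (isSlab_qTransform hq _ h0 _) (.cons (isSlab_qTransform hq _ h1 _)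
    (.cons (isSlab_qTransform hq _ h2 _) (.cons (isSlab_qTransform hq _ h3 _) (.refl _ _))))

end Transform

/-! ### Expansions of Askey–Wilson polynomials -/

section AskeyWilson

variable {K : Type*} [Field K]

/-- After reversing the product, each factor times `q` is `-q⁻¹ ^ (l + i)` times a factor of `qPoch
q q (k + l) / qPoch q q l`. This brings out the `q`-binomial coefficient hidden in the
hypergeometric series. -/
theorem qPoch_zpow_neg {q : K} (hq0 : q ≠ 0) (k l : ℕ) :
    qPoch (q ^ (-((k + l : ℕ) : ℤ))) q k * q ^ k * qPoch q q l =
      (∏ i ∈ Finset.range k, -(q⁻¹ ^ (l + i))) * qPoch q q (k + l) := by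
  rw [add_comm k l, qPoch_add q q l k, qPoch, ← Finset.prod_range_reflect]
  rw [mul_comm (qPoch q q l), ← mul_assoc]
  congr 1
  conv_lhs => rw [← Finset.card_range k, ← Finset.prod_const, Finset.card_range]
  rw [qPoch, ← Finset.prod_mul_distrib, ← Finset.prod_mul_distrib]
  refine Finset.prod_congr rfl fun i hi => ?_
  have hi := Finset.mem_range.1 hi
  have e : q ^ (-((l + k : ℕ) : ℤ)) * q ^ (k - 1 - i) = (q⁻¹) ^ (l + i + 1) := by
    rw [← zpow_natCast, ← zpow_add₀ hq0, inv_pow, ← zpow_natCast, ← zpow_neg]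
    congr 1
    omega
  rw [e]
  have : q⁻¹ ^ (l + i) * q ^ (l + i) = 1 := by rw [← mul_pow, inv_mul_cancel₀ hq0, one_pow]
  have e2 : q⁻¹ ^ (l + i + 1) * q = q⁻¹ ^ (l + i) := by
    rw [pow_succ, mul_assoc, inv_mul_cancel₀ hq0, mul_one]
  have e3 : q * q ^ l * q ^ i = q ^ (l + i) * q := by ring
  rw [sub_mul, e2, e3]
  linear_combination (-q) * this

/-- The coefficients of the Askey–Wilson polynomials in the basis `qPochPair`, up to the
`q`-binomial coefficient. -/
def awKernel (a b c d q : K) (k l : ℕ) : K :=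
  (∏ i ∈ Finset.range k, -(q⁻¹ ^ (l + i))) *
    (qPoch (a * b * q ^ k) q l * qPoch (a * c * q ^ k) q l * qPoch (a * d * q ^ k) q l) /
    ((2 * a) ^ (k + l) * qPoch (a * b * c * d * q ^ (2 * k + l) * q⁻¹) q l)

theorem askeyWilson_eq_qTransform {a b c d q : K} (h2 : (2 : K) ≠ 0) (hq0 : q ≠ 0)
    (hq : ∀ r : ℕ, 1 ≤ r → q ^ r ≠ 1) (ha : a ≠ 0) (hab : ∀ r : ℕ, a * b * q ^ r ≠ 1)
    (hac : ∀ r : ℕ, a * c * q ^ r ≠ 1) (had : ∀ r : ℕ, a * d * q ^ r ≠ 1)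
    (habcd : ∀ r : ℕ, a * b * c * d * q ^ r ≠ 1) :
    askeyWilson a b c d q = qTransform q (awKernel a b c d q) (qPochPair a q) := by
  funext n
  rw [askeyWilson, qTransform, Finset.Nat.sum_antidiagonal_eq_sum_range_succ_mk, Finset.mul_sum]
  refine Finset.sum_congr rfl fun k hk => ?_
  obtain ⟨l, rfl⟩ := Nat.exists_eq_add_of_le (Nat.lt_succ_iff.1 (Finset.mem_range.1 hk))
  rw [add_tsub_cancel_left, ← mul_assoc, ← C_mul, ← smul_eq_C_mul]
  congr 1
  have e1 : a * b * c * d * q ^ (((k + l : ℕ) : ℤ) - 1) = a * b * c * d * q ^ (k + l) * q⁻¹ := by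
    rw [zpow_sub₀ hq0, zpow_one, zpow_natCast, div_eq_mul_inv, mul_assoc (a * b * c * d)]
  have e2 : a * b * c * d * q ^ (k + l) * q⁻¹ * q ^ k =
      a * b * c * d * q ^ (2 * k + l) * q⁻¹ := by ring
  have hz := qPoch_zpow_neg hq0 k l
  have n1 := qPoch_shift_ne_zero hq0 habcd (k + l)
  have n2 := qPoch_ne_zero hab k
  have n3 := qPoch_ne_zero hac k
  have n4 := qPoch_ne_zero had k
  have n5 := qPoch_self_ne_zero hq k
  have n6 := qPoch_self_ne_zero hq l
  rw [qPoch_add, e2] at n1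
  have n7 := left_ne_zero_of_mul n1
  have n8 := right_ne_zero_of_mul n1
  rw [e1, qPoch_add (a * b), qPoch_add (a * c), qPoch_add (a * d),
    qPoch_add (a * b * c * d * q ^ (k + l) * q⁻¹), e2, awKernel, qBinom]
  have hz' : qPoch (q ^ (-((k + l : ℕ) : ℤ))) q k * q ^ k =
      (∏ i ∈ Finset.range k, -(q⁻¹ ^ (l + i))) * qPoch q q (k + l) / qPoch q q l := by
    rw [← hz]; field_simp
  have e3 : ∀ P Q R : K, qPoch (q ^ (-((k + l : ℕ) : ℤ))) q k * P / Q * q ^ k =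
      (∏ i ∈ Finset.range k, -(q⁻¹ ^ (l + i))) * qPoch q q (k + l) / qPoch q q l * P / Q := by
    intro P Q R
    rw [← hz']; ring
  rw [e3 _ _ 0]
  generalize qPoch (a * b * c * d * q ^ (k + l) * q⁻¹) q k = Y1 at *
  generalize qPoch (a * b * c * d * q ^ (2 * k + l) * q⁻¹) q l = Y2 at *
  generalize qPoch (a * b) q k = Y3 at *
  generalize qPoch (a * c) q k = Y4 at *
  generalize qPoch (a * d) q k = Y5 at *
  generalize qPoch q q k = Y6 at *
  generalize qPoch q q l = Y7 at *
  rw [mul_pow]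
  field_simp

/-- The connection coefficients between Askey–Wilson polynomials with parameters `a, b, c, 0`
and `a, b, c, d`, up to the `q`-binomial coefficient. -/
def connKernel (f : ℕ → K) (A B C D q : K) (k l : ℕ) : K :=
  risingProd f k l * qPoch (A * q ^ k) q l * qPoch (C * q ^ k) q l *
    (qPoch (B * q ^ k) q l / qPoch (B * D * q ^ (2 * k)) q l)

theorem askeyWilson_connection {a b c d q : K} (h2 : (2 : K) ≠ 0) (hq0 : q ≠ 0)
    (hq : ∀ r : ℕ, 1 ≤ r → q ^ r ≠ 1) (ha : a ≠ 0) (hab : ∀ r : ℕ, a * b * q ^ r ≠ 1)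
    (hac : ∀ r : ℕ, a * c * q ^ r ≠ 1) (had : ∀ r : ℕ, a * d * q ^ r ≠ 1)
    (habcd : ∀ r : ℕ, a * b * c * d * q ^ r ≠ 1) :
    askeyWilson a b c 0 q = qTransform q (connKernel (fun _ => d / 2) (a * b) (b * c) (a * c)
      (a * d) q) (askeyWilson a b c d q) := by
  rw [askeyWilson_eq_qTransform h2 hq0 hq ha hab hac had habcd,
    askeyWilson_eq_qTransform h2 hq0 hq ha hab hac (by simp) (by simp)]
  refine (qTransform_comp hq (fun k n => ?_) _).symm
  have hx : a * d * q ^ k * (b * c * q ^ k) = a * b * c * d * q ^ (2 * k) := by ring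
  -- Both families are expanded in the basis `qPochPair a q`, which does not involve `d`; the
  -- coefficient comparison at index `k` is the well-poised sum with these arguments.
  have hw := sum_wellPoised hq0 hq n (a * d * q ^ k) (b * c * q ^ k) (fun r => by
    rw [hx, mul_assoc, ← pow_add]; exact habcd _)
  rw [hx] at hw
  simp only [awKernel, mul_zero, zero_mul, qPoch_zero_left, mul_one]
  refine Eq.trans ?_ (mul_one _)
  rw [← hw, Finset.mul_sum]
  refine Finset.sum_congr rfl fun x hx => ?_
  obtain ⟨l, m⟩ := x
  obtain rfl : l + m = n := Finset.HasAntidiagonal.mem_antidiagonal.1 hx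
  dsimp only
  have p1 : ∏ i ∈ Finset.range k, -(q⁻¹ ^ (l + i)) =
      (∏ i ∈ Finset.range k, -(q⁻¹ ^ (l + m + i))) * q ^ (k * m) := by
    rw [mul_comm k m, pow_mul]
    conv_rhs => rw [← Finset.card_range k, ← Finset.prod_const, Finset.card_range]
    rw [← Finset.prod_mul_distrib]
    refine Finset.prod_congr rfl fun i _ => ?_
    rw [add_right_comm, pow_add _ (l + i) m, neg_mul, mul_assoc, ← mul_pow, inv_mul_cancel₀ hq0,
      one_pow, mul_one]
  have hp : ∀ A : K, qPoch (A * q ^ k) q (l + m) =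
      qPoch (A * q ^ k) q l * qPoch (A * q ^ (k + l)) q m := fun A => by
    rw [qPoch_add, pow_add, mul_assoc]
  have s1 : b * c * (a * d) * q ^ (2 * (k + l)) = a * b * c * d * q ^ (2 * k) * q ^ (2 * l) := by
    ring
  have s2 : a * b * c * d * q ^ (2 * k + l) * q⁻¹ =
      a * b * c * d * q ^ (2 * k) * q ^ l * q⁻¹ := by ring
  have s3 : b * c * q ^ (k + l) = b * c * q ^ k * q ^ l := by ring
  have ha2 : 2 * a ≠ 0 := mul_ne_zero h2 ha
  rw [connKernel, p1, hp, hp, s1, s2, s3, risingProd_const]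
  have s4 : (d / 2) ^ m = (a * d) ^ m / (2 * a) ^ m := by
    rw [← div_pow]; congr 1; field_simp
  have s5 : (a * d * q ^ k) ^ m = (a * d) ^ m * q ^ (k * m) := by rw [mul_pow, pow_mul]
  rw [s4, s5, ← add_assoc k l m, pow_add (2 * a) (k + l) m]
  generalize (2 * a) ^ (k + l) = Z1
  generalize (2 * a) ^ m = Z2
  generalize (a * d) ^ m = Z3
  generalize q ^ (k * m) = Z4
  generalize qPoch (a * b * c * d * q ^ (2 * k) * q ^ l * q⁻¹) q l = Y1
  generalize qPoch (a * b * c * d * q ^ (2 * k) * q ^ (2 * l)) q m = Y2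
  generalize qPoch (b * c * q ^ k * q ^ l) q m = Y3
  generalize qPoch (a * d * q ^ k) q l = Y4
  generalize qPoch (a * b * q ^ k) q l = Y5
  generalize qPoch (a * b * q ^ (k + l)) q m = Y6
  generalize qPoch (a * c * q ^ k) q l = Y7
  generalize qPoch (a * c * q ^ (k + l)) q m = Y8
  ring

/-! ### The continuous `q`-Hermite polynomials -/

theorem qPochPair_succ (a q : K) (k : ℕ) : qPochPair a q (k + 1) =
    qPochPair a q k * (1 - C (2 * a * q ^ k) * X + C (a ^ 2 * q ^ (2 * k))) := by
  simp [qPochPair, Finset.prod_range_succ]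

theorem askeyWilson_zero (a b c d q : K) : askeyWilson a b c d q 0 = 1 := by
  simp [askeyWilson, qPoch_zero, qPochPair]

/-- Three-term recurrence for the Askey–Wilson polynomials with one nonzero parameter. -/
theorem askeyWilson_one_param_succ {a q : K} (h2 : (2 : K) ≠ 0) (hq0 : q ≠ 0)
    (hq : ∀ r : ℕ, 1 ≤ r → q ^ r ≠ 1) (ha : a ≠ 0) (n : ℕ) :
    askeyWilson a 0 0 0 q (n + 1) + (q ^ n * (a / 2)) • askeyWilson a 0 0 0 q n =
      X * askeyWilson a 0 0 0 q n - ((1 - q ^ n) / 4) • askeyWilson a 0 0 0 q (n - 1) := by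
  have h4 : (4 : K) ≠ 0 := by
    have : (4 : K) = 2 * 2 := by norm_num
    rw [this]; exact mul_ne_zero h2 h2
  have ha2 : 2 * a ≠ 0 := mul_ne_zero h2 ha
  set s : ℕ → ℕ → K := fun k l => ∏ i ∈ Finset.range k, -(q⁻¹ ^ (l + i)) with hs
  set Y : ℕ → ℕ → K[X] := fun k l => s k l • qPochPair a q k with hY
  set b : ℕ → K[X] := fun n => ∑ x ∈ antidiagonal n, qBinom q x.1 x.2 • Y x.1 x.2 with hb
  have hinv : ∀ k : ℕ, q⁻¹ ^ k * q ^ k = 1 := fun k => by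
    rw [← mul_pow, inv_mul_cancel₀ hq0, one_pow]
  have s1 : ∀ k l, s k l = q ^ k * s k (l + 1) := fun k l => by
    rw [hs]
    dsimp only
    conv_rhs => rw [← Finset.card_range k, ← Finset.prod_const, Finset.card_range]
    rw [← Finset.prod_mul_distrib]
    refine Finset.prod_congr rfl fun i _ => ?_
    rw [add_right_comm l 1 i, pow_succ]
    field_simp
  have s2 : ∀ k l, s (k + 1) l = -(s k l * q⁻¹ ^ (l + k)) := fun k l => by
    simp [hs, Finset.prod_range_succ]
  have hB : ∀ n, askeyWilson a 0 0 0 q n = ((2 * a) ^ n)⁻¹ • b n := fun n => by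
    rw [askeyWilson_eq_qTransform h2 hq0 hq ha (by simp) (by simp) (by simp) (by simp),
      qTransform, hb, Finset.smul_sum]
    refine Finset.sum_congr rfl fun x hx => ?_
    rw [hY]
    simp only [awKernel, mul_zero, zero_mul, qPoch_zero_left, mul_one, smul_smul,
      Finset.HasAntidiagonal.mem_antidiagonal.1 hx, hs]
    congr 1
    ring
  -- Write `q ^ k` as `q ^ (k + l) + q ^ k * (1 - q ^ l)` and use `q ^ k • Y k (l + 1) = Y k l`. At
  -- `n = 0` the truncated index `n - 1` is multiplied by zero.
  have hc : ∀ n, ∑ x ∈ antidiagonal n, qBinom q x.1 x.2 • q ^ x.1 • Y x.1 x.2 =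
      q ^ n • b n + (1 - q ^ n) • b (n - 1) := fun n => by
    rcases n with _ | n
    · simp [hb]
    have := sum_qBinom_sub hq n fun k l => q ^ k • Y k l
    have e : ∀ x : ℕ × ℕ, q ^ x.1 • Y x.1 (x.2 + 1) = Y x.1 x.2 := fun x => by
      rw [hY]; dsimp only; rw [smul_smul, ← s1]
    simp only [e] at this
    rw [Nat.add_sub_cancel, hb]
    dsimp only
    rw [← this, Finset.smul_sum, ← Finset.sum_add_distrib]
    refine Finset.sum_congr rfl fun x hx => ?_
    rw [← Finset.HasAntidiagonal.mem_antidiagonal.1 hx]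
    simp only [smul_smul, ← add_smul]
    congr 1
    ring
  have hbs : ∀ n, b (n + 1) = (2 * a) • (X * b n) -
      a ^ 2 • (q ^ n • b n + (1 - q ^ n) • b (n - 1)) := fun n => by
    rw [← hc, hb]
    dsimp only
    rw [sum_qBinom_succ hq n Y, Finset.mul_sum, Finset.smul_sum, Finset.smul_sum,
      ← Finset.sum_sub_distrib]
    refine Finset.sum_congr rfl fun x hx => ?_
    obtain ⟨k, l⟩ := x
    dsimp only
    rw [hY]
    dsimp only
    rw [s2, s1 k l, qPochPair_succ]
    simp only [smul_eq_C_mul, C_mul, C_neg, C_pow, map_ofNat]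
    have c1 : C q⁻¹ ^ (l + k) * C q ^ k * C q ^ l = (1 : K[X]) := by
      rw [← C_pow, ← C_pow, ← C_pow, ← C_mul, ← C_mul, mul_assoc, ← pow_add, add_comm k l, hinv,
        C_1]
    linear_combination (C (qBinom q k l) * C (s k (l + 1)) * qPochPair a q k *
      (-1 + 2 * C a * C q ^ k * X - C a ^ 2 * C q ^ (2 * k))) * c1
  rw [hB, hB, hB, hbs]
  rcases n with _ | n
  · simp only [pow_zero, sub_self, zero_smul, add_zero, zero_div, one_smul, zero_add, pow_one,
      inv_one, one_mul, zero_mul, smul_sub, smul_smul]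
    rw [inv_mul_cancel₀ ha2, one_smul, sub_add, ← sub_smul]
    have : (2 * a)⁻¹ * a ^ 2 - a / 2 = 0 := by field_simp; ring
    rw [this, zero_smul, sub_zero]
  · rw [Nat.add_sub_cancel, mul_smul_comm]
    simp only [smul_sub, smul_add, smul_smul]
    have e1 : ((2 * a) ^ (n + 1 + 1))⁻¹ * (2 * a) = ((2 * a) ^ (n + 1))⁻¹ := by
      field_simp
      ring
    have e2 : ((2 * a) ^ (n + 1 + 1))⁻¹ * (a ^ 2 * q ^ (n + 1)) =
      q ^ (n + 1) * (a / 2) * ((2 * a) ^ (n + 1))⁻¹ := by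
      field_simp
      ring
    have e3 : ((2 * a) ^ (n + 1 + 1))⁻¹ * (a ^ 2 * (1 - q ^ (n + 1))) =
      (1 - q ^ (n + 1)) / 4 * ((2 * a) ^ n)⁻¹ := by
      field_simp
      ring
    rw [e1, e2, e3]
    abel

/-- The continuous `q`-Hermite polynomials, obtained from the Askey–Wilson polynomials with one
nonzero parameter `a`. -/
def qHermite (a q : K) : ℕ → K[X] :=
  qTransform q (fun _ l => (a / 2) ^ l) (askeyWilson a 0 0 0 q)

/-- The second Pascal rule yields the left side of `askeyWilson_one_param_succ` inside the sum, so
the terms with `a` cancel and only `X` and the lowering term remain. -/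
theorem qHermite_succ {a q : K} (h2 : (2 : K) ≠ 0) (hq0 : q ≠ 0)
    (hq : ∀ r : ℕ, 1 ≤ r → q ^ r ≠ 1) (ha : a ≠ 0) (n : ℕ) :
    qHermite a q (n + 1) = X * qHermite a q n - ((1 - q ^ n) / 4) • qHermite a q (n - 1) := by
  have e : ∀ n, qHermite a q n = ∑ x ∈ antidiagonal n,
      qBinom q x.1 x.2 • (a / 2) ^ x.2 • askeyWilson a 0 0 0 q x.1 := fun n => by
    simp [qHermite, qTransform, mul_smul]
  have e1 : qHermite a q (n + 1) = X * qHermite a q n - ∑ x ∈ antidiagonal n,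
      (qBinom q x.1 x.2 * (1 - q ^ x.1)) • (1 / 4 * (a / 2) ^ x.2) •
        askeyWilson a 0 0 0 q (x.1 - 1) := by
    rw [e, e, sum_qBinom_succ' hq n fun k l => (a / 2) ^ l • askeyWilson a 0 0 0 q k,
      Finset.mul_sum, ← Finset.sum_sub_distrib]
    refine Finset.sum_congr rfl fun x _ => ?_
    have := askeyWilson_one_param_succ h2 hq0 hq ha x.1
    rw [eq_sub_iff_add_eq.2 this]
    simp only [smul_eq_C_mul, C_mul, pow_succ, div_eq_mul_inv, one_mul]
    ring
  rw [e1]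
  congr 1
  rcases n with _ | n
  · simp
  · rw [sum_qBinom_sub' hq n fun k l => (1 / 4 * (a / 2) ^ l) • askeyWilson a 0 0 0 q (k - 1),
      Nat.add_sub_cancel, e, Finset.smul_sum, Finset.smul_sum]
    refine Finset.sum_congr rfl fun x _ => ?_
    simp only [smul_smul, Nat.add_sub_cancel]
    congr 1
    ring

theorem qHermite_zero {a q : K} (hq : ∀ r : ℕ, 1 ≤ r → q ^ r ≠ 1) : qHermite a q 0 = 1 := by
  simp [qHermite, qTransform, askeyWilson_zero, qBinom_zero_left hq]

/-- The recurrence and the initial value are free of `a`. This allows the bottom three levels to use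
`a = 1` and the higher ones the given parameter. -/
theorem qHermite_param_indep {a a' q : K} (h2 : (2 : K) ≠ 0) (hq0 : q ≠ 0)
    (hq : ∀ r : ℕ, 1 ≤ r → q ^ r ≠ 1) (ha : a ≠ 0) (ha' : a' ≠ 0) :
    qHermite a q = qHermite a' q := by
  funext n
  induction n using Nat.strong_induction_on with
  | _ n ih =>
    rcases n with _ | n
    · rw [qHermite_zero hq, qHermite_zero hq]
    · rw [qHermite_succ h2 hq0 hq ha, qHermite_succ h2 hq0 hq ha', ih n (by omega),
        ih (n - 1) (by omega)]

end AskeyWilson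

/-! ### The weight system of the Askey–Wilson polynomials -/

section Weights

variable {K : Type*} [Field K]

theorem height_wH {q : K} (h2 : (2 : K) ≠ 0) : height (wH q) = 3 := by
  refine le_antisymm (sInf_le ⟨3, rfl, fun t i j ht _ => ?_⟩) (le_sInf ?_)
  · obtain ⟨s, rfl⟩ := Nat.exists_eq_add_of_le' ht
    rfl
  · rintro _ ⟨l, rfl, hl⟩
    by_contra h
    have hl' : l < 3 := by
      rw [not_le] at h
      exact_mod_cast h
    have := hl 2 0 0 (by omega) le_rfl
    simp [wH, h2] at this

theorem wAW_eq_wH {a b c d q : K} (h2 : (2 : K) ≠ 0) {t : ℕ} (ht : t < 3)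
    (i j : ℕ) : wAW a b c d q t i j = wH q t i j := by
  have : (t : ℕ∞) < 3 := by exact_mod_cast ht
  simp [wAW, stack, height_wH h2, this]

theorem wAW_add_three {a b c d q : K} (h2 : (2 : K) ≠ 0) (t i j : ℕ) :
    wAW a b c d q (3 + t) i j = wAWH a b c d q t i j := by
  have : ¬ ((3 + t : ℕ) : ℕ∞) < 3 := by
    rw [not_lt]; exact_mod_cast Nat.le_add_right 3 t
  have h3 : (3 : ℕ∞).toNat = 3 := rfl
  simp only [wAW, stack, height_wH h2, this, h3, if_false, Nat.add_sub_cancel_left]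

theorem wAWH_eight_mul {a b c d q : K} (m i j : ℕ) :
    wAWH a b c d q (8 * m + 1) i j = 1 / 2 * (a * b * c * d * q ^ (2 * i)) ^ m * q ^ j * b ∧
    wAWH a b c d q (8 * m + 2) i j = 1 / 2 * (a * b * c * d * q ^ (2 * i)) ^ m * q ^ j * c ∧
    wAWH a b c d q (8 * m + 3) i j =
      1 / 2 * (a * b * c * d * q ^ (2 * i)) ^ m * q ^ j * (-(a * b * c) * q ^ i) ∧
    wAWH a b c d q (8 * m + 4) i j = 1 / 2 * (a * b * c * d * q ^ (2 * i)) ^ m * q ^ j * d ∧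
    wAWH a b c d q (8 * m + 5) i j =
      1 / 2 * (a * b * c * d * q ^ (2 * i)) ^ m * q ^ j * (-(a * b * d) * q ^ i) ∧
    wAWH a b c d q (8 * m + 6) i j =
      1 / 2 * (a * b * c * d * q ^ (2 * i)) ^ m * q ^ j * (-(a * c * d) * q ^ i) ∧
    wAWH a b c d q (8 * m + 7) i j =
      1 / 2 * (a * b * c * d * q ^ (2 * i)) ^ m * q ^ j * (a ^ 2 * b * c * d * q ^ (2 * i)) := by
  refine ⟨?_, ?_, ?_, ?_, ?_, ?_, ?_⟩ <;>
  simp [wAWH, Nat.add_mod, Nat.mul_add_div]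

theorem wAWH_zero {a b c d q : K} (i j : ℕ) :
    wAWH a b c d q 0 i j = 1 / 2 * q ^ j * a := by
  simp [wAWH]

/-- The exceptional entry with `a⁻¹` cancels one factor `a * q ^ i` of the next power, so the weight
continues the pattern of the preceding block. -/
theorem wAWH_eight_mul_add_eight {a b c d q : K} (hq0 : q ≠ 0) (ha : a ≠ 0) (m i j : ℕ) :
    wAWH a b c d q (8 * m + 8) i j =
      1 / 2 * (a * b * c * d * q ^ (2 * i)) ^ m * q ^ j * (-(b * c * d) * q ^ i) := by
  have e : (8 * m + 8) / 8 = m + 1 := by omega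
  have e2 : (8 * m + 8) % 8 = 0 := by omega
  simp only [wAWH, e, e2, if_neg (show ¬ 8 * m + 8 = 0 by omega)]
  rw [zpow_neg, zpow_natCast, pow_succ]
  have : q ^ (2 * i) = q ^ i * q ^ i := by rw [two_mul, pow_add]
  rw [this]
  field_simp

/-- The top four levels of a block of eight and the bottom four of the next one. -/
theorem isChain_block {a b c d q : K} (h2 : (2 : K) ≠ 0) (hq0 : q ≠ 0)
    (hq : ∀ r : ℕ, 1 ≤ r → q ^ r ≠ 1) (ha : a ≠ 0)
    (habcd : ∀ r : ℕ, a * b * c * d * q ^ r ≠ 1) {V : Type*} [AddCommGroup V] [Module K V]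
    (p : ℕ → V) (m : ℕ) :
    IsChain (wAW a b c d q) (7 + 8 * m) (7 + 8 * (m + 1))
      (qTransform q (connKernel (fun i => 1 / 2 * (a * b * c * d * q ^ (2 * i)) ^ m * d)
        (a * b) (b * c) (a * c) (a * d) q) p)
      (qTransform q (connKernel (fun i => 1 / 2 * (a * b * c * d * q ^ (2 * i)) ^ (m + 1) * d)
        (a * b) (b * c) (a * c) (a * d) q) p) := by
  have hw : ∀ r i j, wAW a b c d q (7 + 8 * m + r) i j = wAWH a b c d q (8 * m + (4 + r)) i j :=
    fun r i j => by rw [← wAW_add_three h2]; congr 1; omega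
  have hw' : ∀ r i j, wAW a b c d q (7 + 8 * m + 4 + r) i j =
      wAWH a b c d q (8 * m + 8 + r) i j :=
    fun r i j => by rw [← wAW_add_three h2]; congr 1; omega
  obtain ⟨f, hf⟩ : ∃ f : ℕ → K, f = fun i => 1 / 2 * (a * b * c * d * q ^ (2 * i)) ^ m * d :=
    ⟨_, rfl⟩
  rw [← hf]
  have c1 := isChain_four hq (w := wAW a b c d q) (t := 7 + 8 * m) f (a * b) (b * c) (a * c)
    (a * d) (fun r => by
      rw [show b * c * (a * d) * q ^ r = a * b * c * d * q ^ r by ring]; exact habcd r)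
    ?_ ?_ ?_ ?_ p
  -- The second half exchanges the roles of `b * c` and `a * d`; its base weight contains the factor
  -- `-(b * c * q ^ i)` left behind by the first half.
  have c2 := isChain_four hq (w := wAW a b c d q) (t := 7 + 8 * m + 4)
    (fun i => f i * -(b * c * q ^ i)) (a * b) (a * d) (a * c)
    (b * c) ?_ ?_ ?_ ?_ ?_ p
  · have e1 : (fun k l => risingProd f k l * qPoch (a * b * q ^ k) q l *
        qPoch (a * c * q ^ k) q l * risingProd (fun i => -(b * c * q ^ i)) k l *
        (qPoch (a * d * q ^ k) q l / qPoch (b * c * (a * d) * q ^ (2 * k)) q l)) =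
        fun k l => risingProd (fun i => f i * -(b * c * q ^ i)) k l * qPoch (a * b * q ^ k) q l *
        qPoch (a * c * q ^ k) q l *
        (qPoch (a * d * q ^ k) q l / qPoch (a * d * (b * c) * q ^ (2 * k)) q l) := by
      funext k l
      rw [risingProd_mul, mul_comm (a * d) (b * c)]
      ring
    have e2 : (fun k l => risingProd (fun i => f i * -(b * c * q ^ i)) k l *
        qPoch (a * b * q ^ k) q l *
        qPoch (a * c * q ^ k) q l * risingProd (fun i => -(a * d * q ^ i)) k l *
        (qPoch (b * c * q ^ k) q l / qPoch (a * d * (b * c) * q ^ (2 * k)) q l)) =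
        connKernel (fun i => 1 / 2 * (a * b * c * d * q ^ (2 * i)) ^ (m + 1) * d)
        (a * b) (b * c) (a * c) (a * d) q := by
      funext k l
      have e3 : (fun i => 1 / 2 * (a * b * c * d * q ^ (2 * i)) ^ (m + 1) * d) =
          fun i => f i * -(b * c * q ^ i) * -(a * d * q ^ i) := by
        funext i
        simp only [hf]
        ring
      rw [connKernel, e3, risingProd_mul (fun i => f i * -(b * c * q ^ i)),
        mul_comm (a * d) (b * c)]
      ring
    rw [e1] at c1
    rw [e2] at c2
    exact c1.trans c2
  · intro r
    have := habcd r
    rwa [show a * d * (b * c) * q ^ r = a * b * c * d * q ^ r by ring]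
  · intro i j
    rw [← add_zero (7 + 8 * m + 4), hw', add_zero, wAWH_eight_mul_add_eight hq0 ha]
    simp only [hf]; ring
  · intro i j
    rw [hw', show 8 * m + 8 + 1 = 8 * (m + 1) + 1 by ring, (wAWH_eight_mul _ _ _).1]
    simp only [hf]; ring
  · intro i j
    rw [hw', show 8 * m + 8 + 2 = 8 * (m + 1) + 2 by ring, (wAWH_eight_mul _ _ _).2.1]
    simp only [hf]; ring
  · intro i j
    rw [hw', show 8 * m + 8 + 3 = 8 * (m + 1) + 3 by ring, (wAWH_eight_mul _ _ _).2.2.1]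
    simp only [hf]; ring
  · intro i j
    rw [← add_zero (7 + 8 * m), hw, add_zero 4, (wAWH_eight_mul _ _ _).2.2.2.1]
    simp only [hf]; ring
  · intro i j
    rw [hw, (wAWH_eight_mul _ _ _).2.2.2.2.1]
    simp only [hf]; ring
  · intro i j
    rw [hw, (wAWH_eight_mul _ _ _).2.2.2.2.2.1]
    simp only [hf]; ring
  · intro i j
    rw [hw, (wAWH_eight_mul _ _ _).2.2.2.2.2.2]
    simp only [hf]; ring

/-- The connection formula changes only the last parameter; rotation lets it introduce `b` and `c`
too. -/
theorem askeyWilson_rotate (a b c d q : K) : askeyWilson a b c d q = askeyWilson a c d b q := by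
  funext n
  have e1 : a * c * d * b = a * b * c * d := by ring
  have e2 : ∀ x y z : K, y * z * x = x * y * z := fun x y z => by ring
  simp only [askeyWilson, e1, e2 (qPoch (a * b) q _)]

/-- Newton interpolation as a slab with weights that do not depend on the column. -/
theorem isSlab_newton {w : ℕ → ℕ → K} (x : ℕ → K) (hw : ∀ i j, w i j = x j) :
    IsSlab w (fun n => (X : K[X]) ^ n) fun n => ∏ r ∈ Finset.range n, (X - C (x r)) := by
  refine ⟨fun n j => (∏ r ∈ Finset.range j, (X - C (x r))) * X ^ (n - j), by simp, by simp,
    fun n j hj => ?_⟩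
  obtain ⟨m, rfl⟩ := Nat.exists_eq_add_of_le hj
  have e1 : j + m + 1 - j = m + 1 := by omega
  have e2 : j + m + 1 - (j + 1) = m := by omega
  have e3 : j + m - j = m := by omega
  simp only [e1, e2, e3, hw, Finset.prod_range_succ, smul_eq_C_mul]
  ring

theorem isChain_wH {a b c d q : K} (h2 : (2 : K) ≠ 0) (hq0 : q ≠ 0)
    (hq : ∀ r : ℕ, 1 ≤ r → q ^ r ≠ 1) :
    IsChain (wAW a b c d q) 0 3 (fun n => (X : K[X]) ^ n) (qHermite 1 q) := by
  have hw0 : ∀ i j, wAW a b c d q 0 i j = (q ^ (j : ℤ) + q ^ (-(j : ℤ))) / 2 :=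
    fun i j => wAW_eq_wH h2 (by norm_num) i j
  have hw1 : ∀ i j, wAW a b c d q 1 i j = -(q⁻¹ ^ i) / 2 * q ^ j := fun i j => by
    rw [wAW_eq_wH h2 (by norm_num), wH, zpow_sub₀ hq0, zpow_natCast, zpow_natCast, inv_pow]
    ring
  have hw2 : ∀ i j, j ≤ i → wAW a b c d q 2 i j = -1 / 2 * q ^ (i - j) := fun i j hj => by
    rw [wAW_eq_wH h2 (by norm_num), wH, ← Nat.cast_sub hj, zpow_natCast]
    ring
  have s0 := isSlab_newton _ hw0
  have s1 := isSlab_qTransform hq _ hw1 (askeyWilson 1 0 0 0 q)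
  have s2 := isSlab_qTransform_inv hq _ hw2 (qHermite 1 q)
  have e2 : qTransform q (fun _ l => ∏ i ∈ Finset.range l, (-1 / 2 * q ^ i)) (qHermite 1 q) =
      askeyWilson 1 0 0 0 q := by
    -- The level 2 kernel inverts the one that defines `qHermite`, by the alternating `q`-binomial
    -- sum.
    rw [qHermite, qTransform_comp hq (e₃ := fun k n => if n = 0 then (fun _ => 1) k else 0),
      qTransform_diag hq]
    · simp
    · intro k n
      have e : (if n = 0 then (1 : K) else 0) = (1 / 2) ^ n * (if n = 0 then 1 else 0) := by
        split_ifs with h <;> simp [h]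
      rw [e, ← sum_qBinom_alternating hq, ← Finset.Nat.sum_antidiagonal_swap, Finset.mul_sum]
      refine Finset.sum_congr rfl fun x hx => ?_
      rw [← Finset.HasAntidiagonal.mem_antidiagonal.1 hx]
      have : ∏ i ∈ Finset.range x.1, (-1 / 2 * q ^ i) =
          (1 / 2) ^ x.1 * ∏ i ∈ Finset.range x.1, -q ^ i := by
        conv_rhs => rw [← Finset.card_range x.1, ← Finset.prod_const, Finset.card_range]
        rw [← Finset.prod_mul_distrib]
        exact Finset.prod_congr rfl fun i _ => by ring
      simp only [Prod.fst_swap, Prod.snd_swap]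
      rw [this, qBinom_comm, pow_add]
      ring
  have e1 : qTransform q (risingProd fun i => -(q⁻¹ ^ i) / 2) (askeyWilson 1 0 0 0 q) =
      fun n => ∏ r ∈ Finset.range n, (X - C ((q ^ (r : ℤ) + q ^ (-(r : ℤ))) / 2)) := by
    -- For `a = 1` the factors of `qPochPair` are proportional to `X` minus the Newton nodes. The
    -- level 1 kernel undoes the expansion in this basis up to the diagonal factor that makes the
    -- products monic.
    rw [askeyWilson_eq_qTransform h2 hq0 hq one_ne_zero (by simp) (by simp) (by simp) (by simp),
      qTransform_comp hq (e₃ := fun k n => if n = 0 then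
        (fun k => ∏ r ∈ Finset.range k, (-(q⁻¹ ^ r) / 2)) k else 0), qTransform_diag hq]
    · funext n
      rw [qPochPair, smul_eq_C_mul, map_prod, ← Finset.prod_mul_distrib]
      refine Finset.prod_congr rfl fun r _ => ?_
      have c1 : C (q⁻¹ ^ r) * C (q ^ r) = (1 : K[X]) := by
        rw [← C_mul, ← mul_pow, inv_mul_cancel₀ hq0, one_pow, C_1]
      have c2 : C (2 : K)⁻¹ * C 2 = (1 : K[X]) := by
        rw [← C_mul, inv_mul_cancel₀ h2, C_1]
      have c3 : q ^ (2 * r) = q ^ r * q ^ r := by rw [two_mul, pow_add]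
      rw [zpow_neg, zpow_natCast, ← inv_pow, c3]
      simp only [div_eq_mul_inv, C_mul, C_neg, C_add, mul_one, one_pow, one_mul]
      linear_combination (X * C (2 : K)⁻¹ * C 2 - C (2 : K)⁻¹ * C (q ^ r)) * c1 + X * c2
    · intro k n
      have e : (if n = 0 then (∏ r ∈ Finset.range k, (-(q⁻¹ ^ r) / 2) : K) else 0) =
          risingProd (fun i => -(q⁻¹ ^ i) / 2) k n * (∏ r ∈ Finset.range k, (-(q⁻¹ ^ r) / 2)) *
          (if n = 0 then 1 else 0) := by
        split_ifs with h <;> simp [h, risingProd]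
      rw [e, ← sum_qBinom_alternating hq, Finset.mul_sum]
      refine Finset.sum_congr rfl fun x hx => ?_
      obtain ⟨l, m⟩ := x
      obtain rfl : l + m = n := Finset.HasAntidiagonal.mem_antidiagonal.1 hx
      dsimp only
      have a1 : ∏ i ∈ Finset.range k, -(q⁻¹ ^ (l + i)) =
          (∏ r ∈ Finset.range k, (-(q⁻¹ ^ r) / 2)) * (2 ^ k * (q⁻¹ ^ k) ^ l) := by
        rw [pow_right_comm, ← mul_pow]
        conv_rhs => rw [← Finset.card_range k, ← Finset.prod_const, Finset.card_range]
        rw [← Finset.prod_mul_distrib]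
        refine Finset.prod_congr rfl fun i _ => ?_
        rw [pow_add]
        field_simp
      have a2 : risingProd (fun i => -(q⁻¹ ^ i) / 2) k l * (∏ i ∈ Finset.range l, -q ^ i) * 2 ^ l =
          (q⁻¹ ^ k) ^ l := by
        rw [risingProd, ← Finset.prod_mul_distrib]
        conv_lhs => enter [2]; rw [← Finset.card_range l, ← Finset.prod_const]
        conv_rhs => rw [← Finset.card_range l, ← Finset.prod_const]
        rw [← Finset.prod_mul_distrib]
        refine Finset.prod_congr rfl fun i _ => ?_
        rw [pow_add]
        have : q⁻¹ ^ i * q ^ i = 1 := by rw [← mul_pow, inv_mul_cancel₀ hq0, one_pow]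
        field_simp
        linear_combination this
      rw [risingProd_add, awKernel, a1, ← a2]
      simp only [mul_zero, zero_mul, qPoch_zero_left, mul_one]
      rw [pow_add]
      field_simp
  rw [e2] at s2
  rw [e1] at s1
  exact .cons s0 (.cons s1 (.cons s2 (.refl _ _)))

theorem isChain_three_params {a b c d q : K} (h2 : (2 : K) ≠ 0) (hq0 : q ≠ 0)
    (hq : ∀ r : ℕ, 1 ≤ r → q ^ r ≠ 1) (ha : a ≠ 0) (hab : ∀ r : ℕ, a * b * q ^ r ≠ 1)
    (hac : ∀ r : ℕ, a * c * q ^ r ≠ 1) :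
    IsChain (wAW a b c d q) 3 7 (qHermite a q) (askeyWilson a b c 0 q) := by
  have hw : ∀ r i j, wAW a b c d q (3 + r) i j = wAWH a b c d q (8 * 0 + r) i j :=
    fun r i j => by rw [wAW_add_three h2, mul_zero, zero_add]
  have w3 : ∀ i j, wAW a b c d q 3 i j = (fun _ => a / 2) i * q ^ j := fun i j => by
    rw [← add_zero 3, hw, mul_zero, add_zero, wAWH_zero]; ring
  have w4 : ∀ i j, wAW a b c d q 4 i j = (fun _ => b / 2) i * q ^ j := fun i j => by
    rw [show 4 = 3 + 1 from rfl, hw, (wAWH_eight_mul _ _ _).1]; ring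
  have w5 : ∀ i j, wAW a b c d q 5 i j = (fun _ => c / 2) i * q ^ j := fun i j => by
    rw [show 5 = 3 + 2 from rfl, hw, (wAWH_eight_mul _ _ _).2.1]; ring
  have w6 : ∀ i j, wAW a b c d q 6 i j = (fun i => c / 2 * -(a * b * q ^ i)) i * q ^ j :=
    fun i j => by
      rw [show 6 = 3 + 3 from rfl, hw, (wAWH_eight_mul _ _ _).2.2.1]; ring
  have s3 := isSlab_qTransform hq _ w3 (askeyWilson a 0 0 0 q)
  have s4 := isSlab_qTransform hq _ w4 (askeyWilson a b 0 0 q)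
  have s6 := isSlab_qTransform hq _ w6 (askeyWilson a b c 0 q)
  have s5 := isSlab_qTransform hq _ w5 (qTransform q (risingProd fun i => c / 2 * -(a * b * q ^ i))
    (askeyWilson a b c 0 q))
  have e3 : qTransform q (risingProd fun _ => a / 2) (askeyWilson a 0 0 0 q) = qHermite a q := by
    rw [qHermite]; congr 1; funext k l; exact risingProd_const _ _ _
  have e4 : qTransform q (risingProd fun _ => b / 2) (askeyWilson a b 0 0 q) =
      askeyWilson a 0 0 0 q := by
    have hc := askeyWilson_connection (b := 0) (c := 0) (d := b) h2 hq0 hq ha (by simp) (by simp)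
      hab (by simp)
    rw [askeyWilson_rotate a 0 0 b, askeyWilson_rotate a 0 b 0] at hc
    rw [hc]
    congr 1
    funext k l
    simp [connKernel, qPoch_zero_left]
  have e5 : qTransform q (risingProd fun _ => c / 2) (qTransform q (risingProd fun i =>
      c / 2 * -(a * b * q ^ i)) (askeyWilson a b c 0 q)) = askeyWilson a b 0 0 q := by
    have hc := askeyWilson_connection (b := 0) (c := b) (d := c) h2 hq0 hq ha (by simp) hab hac
      (by simp)
    rw [askeyWilson_rotate a 0 b 0, askeyWilson_rotate a 0 b c] at hc
    rw [hc]
    -- The connection kernel for `c` contains `(ab q^k; q)_l`, hence takes two levels.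
    have := qTransform_comp_cocycle' hq (u := risingProd fun _ => c / 2) (risingProd_add _)
      (a * b) (askeyWilson a b c 0 q)
    have m1 : (fun k l => risingProd (fun _ => c / 2) k l *
        risingProd (fun i => -(a * b * q ^ i)) k l) =
        risingProd (fun i => c / 2 * -(a * b * q ^ i)) := by
      funext k l; rw [← risingProd_mul]
    rw [m1] at this
    rw [this]
    congr 1
    funext k l
    simp [connKernel, qPoch_zero_left]
  rw [e3] at s3
  rw [e4] at s4
  rw [e5] at s5
  exact .cons s3 (.cons s4 (.cons s5 (.cons s6 (.refl _ _))))

theorem isChain_wAW {a b c d q : K} (h2 : (2 : K) ≠ 0) (hq0 : q ≠ 0)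
    (hq : ∀ r : ℕ, 1 ≤ r → q ^ r ≠ 1) (ha : a ≠ 0) (hab : ∀ r : ℕ, a * b * q ^ r ≠ 1)
    (hac : ∀ r : ℕ, a * c * q ^ r ≠ 1) (had : ∀ r : ℕ, a * d * q ^ r ≠ 1)
    (habcd : ∀ r : ℕ, a * b * c * d * q ^ r ≠ 1) (m : ℕ) :
    IsChain (wAW a b c d q) 0 (7 + 8 * m) (fun n => (X : K[X]) ^ n)
      (qTransform q (connKernel (fun i => 1 / 2 * (a * b * c * d * q ^ (2 * i)) ^ m * d)
        (a * b) (b * c) (a * c) (a * d) q) (askeyWilson a b c d q)) := by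
  induction m with
  | zero =>
    have h1 : IsChain (wAW a b c d q) 0 3 (fun n => (X : K[X]) ^ n) (qHermite a q) := by
      rw [qHermite_param_indep h2 hq0 hq ha one_ne_zero]
      exact isChain_wH h2 hq0 hq
    have h := h1.trans (isChain_three_params h2 hq0 hq ha hab hac)
    rw [askeyWilson_connection h2 hq0 hq ha hab hac had habcd] at h
    convert h using 5
    ring
  | succ m ih => exact ih.trans (isChain_block h2 hq0 hq ha habcd _ m)

end Weights

/-! ### Paths in the lecture hall graph -/

section Paths

theorem Vertex.ext' {u v : Vertex} (ht : u.t = v.t) (hi : u.i = v.i) (hj : u.j = v.j) : u = v := by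
  cases u; cases v; simp_all

/-- The vertex from which there is a south step to `v`. -/
def Vertex.up (v : Vertex) : Vertex :=
  if h : v.j < v.i then ⟨v.t, v.i, v.j + 1, h⟩ else ⟨v.t + 1, v.i, 0, Nat.zero_le _⟩

/-- The vertex from which there is an east step to `v`, if `v.j < v.i`. -/
def Vertex.west (v : Vertex) : Vertex := ⟨v.t, v.i - 1, min v.j (v.i - 1), min_le_right _ _⟩

theorem Vertex.up_i (v : Vertex) : v.up.i = v.i := by
  unfold Vertex.up; split_ifs <;> rfl

theorem Vertex.le_up_t (v : Vertex) : v.t ≤ v.up.t := by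
  unfold Vertex.up; split_ifs <;> simp

theorem Vertex.up_y (v : Vertex) : v.up.y = v.y + 1 / ((v.i : ℚ) + 1) := by
  have h0 : (v.i : ℚ) + 1 ≠ 0 := by positivity
  unfold Vertex.up Vertex.y
  split_ifs with h
  · push_cast
    field_simp
    ring
  · have : v.j = v.i := le_antisymm v.hj (not_lt.1 h)
    rw [this]
    push_cast
    field_simp
    ring

theorem isSouthStep_iff {u v : Vertex} : IsSouthStep u v ↔ u = v.up := by
  have hu := u.hj
  have hv := v.hj
  constructor
  · rintro ⟨hi, ⟨ht, hj⟩ | ⟨ht, hj, hj'⟩⟩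
    · rw [Vertex.up, dif_pos (by omega)]
      exact Vertex.ext' ht.symm hi.symm hj
    · rw [Vertex.up, dif_neg (by omega)]
      exact Vertex.ext' ht hi.symm hj
  · rintro rfl
    unfold Vertex.up
    split_ifs with h
    · exact ⟨rfl, Or.inl ⟨rfl, rfl⟩⟩
    · exact ⟨rfl, Or.inr ⟨rfl, rfl, le_antisymm hv (not_lt.1 h)⟩⟩

theorem isEastStep_iff {u v : Vertex} : IsEastStep u v ↔ v.j < v.i ∧ u = v.west := by
  have hu := u.hj
  constructor
  · rintro ⟨ht, hi, hj⟩
    refine ⟨by omega, Vertex.ext' ht.symm ?_ ?_⟩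
    · simp only [Vertex.west]; omega
    · simp only [Vertex.west]; omega
  · rintro ⟨h, rfl⟩
    refine ⟨rfl, ?_, ?_⟩ <;> simp only [Vertex.west] <;> omega

theorem not_isEastStep_up (v : Vertex) : ¬ IsEastStep v.up v := fun h => by
  have := h.2.1
  rw [v.up_i] at this
  omega

/-- Induction along the steps of paths that stay straight above level `T`. -/
theorem vertex_induction {T : ℕ} {motive : Vertex → Prop}
    (top : ∀ i, motive ⟨T, i, 0, Nat.zero_le i⟩)
    (step : ∀ v : Vertex, v.t < T → motive v.up → (v.j < v.i → motive v.west) → motive v)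
    (v : Vertex) (hv : v.t < T) : motive v := by
  -- Lexicographic induction on `T - t`, `i` and `i - j`. Height `T` itself is entered only at `j =
  -- 0`, by a south step out of its bottom vertex.
  have key : ∀ s t, t + s = T → (∀ i j (h : j ≤ i), j = 0 ∨ t < T → motive ⟨t, i, j, h⟩) := by
    intro s
    induction s with
    | zero =>
      rintro t rfl i j h h0
      obtain rfl : j = 0 := by omega
      exact top i
    | succ s ihs =>
      intro t ht i
      induction i with
      | zero =>
        intro j h _
        obtain rfl : j = 0 := by omega
        refine step _ (by dsimp only; omega) ?_ fun h' => absurd h' (lt_irrefl _)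
        exact ihs (t + 1) (by omega) 0 0 le_rfl (Or.inl rfl)
      | succ i ihi =>
        have key2 : ∀ d j (h : j ≤ i + 1), j + d = i + 1 → motive ⟨t, i + 1, j, h⟩ := by
          intro d
          induction d with
          | zero =>
            intro j h hd
            obtain rfl : j = i + 1 := by omega
            refine step _ (by dsimp only; omega) ?_ fun h' => absurd h' (lt_irrefl _)
            rw [Vertex.up, dif_neg (lt_irrefl _)]
            exact ihs (t + 1) (by omega) (i + 1) 0 (Nat.zero_le _) (Or.inl rfl)
          | succ d ihd =>
            intro j h hd
            refine step _ (by dsimp only; omega) ?_ fun _ => ?_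
            · rw [Vertex.up, dif_pos (by dsimp only; omega)]
              exact ihd (j + 1) (by omega) (by omega)
            · have := ihi j (by omega) (Or.inr (by omega))
              convert this using 1
              exact Vertex.ext' rfl rfl (by simp only [Vertex.west]; omega)
        intro j h _
        exact key2 (i + 1 - j) j h (by omega)
  exact key (T - v.t) v.t (by omega) v.i v.j v.hj (Or.inr hv)

/-- The paths from `(k, ∞)` to the vertex `v`, as sequences of vertices. -/
def paths (k : ℕ) (v : Vertex) : Set (ℕ → Vertex) :=
  {f | f 0 = v ∧ (∀ m, IsEastStep (f (m + 1)) (f m) ∨ IsSouthStep (f (m + 1)) (f m)) ∧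
    (∀ᶠ m in atTop, (f m).i = k) ∧ Tendsto (fun m => (f m).y) atTop atTop}

/-- The paths from `(k, ∞)` to the vertex `v` whose east steps are all below level `T`. -/
def pathsBelow (T k : ℕ) (v : Vertex) : Set (ℕ → Vertex) :=
  {f | f ∈ paths k v ∧ ∀ m, IsEastStep (f (m + 1)) (f m) → (f (m + 1)).t < T}

/-- Prepend a vertex to a sequence. -/
def consVertex (v : Vertex) (f : ℕ → Vertex) : ℕ → Vertex
  | 0 => v
  | m + 1 => f m

theorem consVertex_injective (v : Vertex) : Function.Injective (consVertex v) := fun f g h => by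
  funext m
  exact congrFun h (m + 1)

theorem consVertex_mem_paths {k : ℕ} {u v : Vertex} {f : ℕ → Vertex} (hf : f ∈ paths k u)
    (h : IsEastStep u v ∨ IsSouthStep u v) : consVertex v f ∈ paths k v := by
  obtain ⟨h0, h1, h2, h3⟩ := hf
  refine ⟨rfl, ?_, ?_, ?_⟩
  · rintro (_ | m)
    · simpa [consVertex, h0] using h
    · exact h1 m
  · rw [← map_add_atTop_eq_nat 1, eventually_map]
    exact h2
  · rw [← tendsto_add_atTop_iff_nat 1]
    exact h3

theorem tail_mem_paths {k : ℕ} {v : Vertex} {f : ℕ → Vertex} (hf : f ∈ paths k v) :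
    (fun m => f (m + 1)) ∈ paths k (f 1) := by
  obtain ⟨h0, h1, h2, h3⟩ := hf
  refine ⟨rfl, fun m => h1 (m + 1), ?_, ?_⟩
  · rw [← map_add_atTop_eq_nat 1, eventually_map] at h2
    exact h2
  · rw [← tendsto_add_atTop_iff_nat 1] at h3
    exact h3

theorem consVertex_mem_pathsBelow {T k : ℕ} {u v : Vertex} {f : ℕ → Vertex}
    (hf : f ∈ pathsBelow T k u) (h : (IsEastStep u v ∧ u.t < T) ∨ IsSouthStep u v) :
    consVertex v f ∈ pathsBelow T k v := by
  refine ⟨consVertex_mem_paths hf.1 (h.imp_left And.left), ?_⟩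
  rintro (_ | m) hm
  · have hm' : IsEastStep u v := by simpa [consVertex, hf.1.1] using hm
    rcases h with h | h
    · simpa [consVertex, hf.1.1] using h.2
    · rw [isSouthStep_iff] at h
      exact absurd (h ▸ hm') (not_isEastStep_up v)
  · exact hf.2 m hm

-- A path ending at `v` is determined by its last step and the rest. The test `v.j < v.i` decides
-- whether `v` has a western neighbour.
open Classical in
theorem pathsBelow_eq {T k : ℕ} {v : Vertex} (hv : v.t < T) :
    pathsBelow T k v = consVertex v '' pathsBelow T k v.up ∪
      if v.j < v.i then consVertex v '' pathsBelow T k v.west else ∅ := by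
  ext f
  constructor
  · intro hf
    have e : consVertex v (fun m => f (m + 1)) = f := by
      funext m
      rcases m with _ | m
      · exact hf.1.1.symm
      · rfl
    have ht : (fun m => f (m + 1)) ∈ pathsBelow T k (f 1) :=
      ⟨tail_mem_paths hf.1, fun m => hf.2 (m + 1)⟩
    rcases hf.1.2.1 0 with h | h
    · rw [isEastStep_iff, zero_add, hf.1.1] at h
      right
      rw [if_pos h.1]
      exact ⟨_, h.2 ▸ ht, e⟩
    · rw [isSouthStep_iff, zero_add, hf.1.1] at h
      exact Or.inl ⟨_, h ▸ ht, e⟩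
  · rintro (⟨g, hg, rfl⟩ | h)
    · exact consVertex_mem_pathsBelow hg (Or.inr (isSouthStep_iff.2 rfl))
    · split_ifs at h with hji
      · obtain ⟨g, hg, rfl⟩ := h
        exact consVertex_mem_pathsBelow hg (Or.inl ⟨isEastStep_iff.2 ⟨hji, rfl⟩, hv⟩)
      · exact h.elim

theorem iterate_up_i (v : Vertex) (m : ℕ) : (Vertex.up^[m] v).i = v.i := by
  induction m with
  | zero => rfl
  | succ m ih => rw [Function.iterate_succ_apply', Vertex.up_i, ih]

theorem iterate_up_y (v : Vertex) (m : ℕ) :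
    (Vertex.up^[m] v).y = v.y + m * (1 / ((v.i : ℚ) + 1)) := by
  induction m with
  | zero => simp
  | succ m ih =>
    rw [Function.iterate_succ_apply', Vertex.up_y, ih, iterate_up_i]
    push_cast
    ring

-- At height `T` no east step is allowed any more, so the path goes straight up and must already be
-- in column `k`.
open Classical in
theorem pathsBelow_top (T k i : ℕ) : pathsBelow T k ⟨T, i, 0, Nat.zero_le i⟩ =
    if i = k then {fun m => Vertex.up^[m] ⟨T, i, 0, Nat.zero_le i⟩} else ∅ := by
  set v : Vertex := ⟨T, i, 0, Nat.zero_le i⟩ with hv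
  have key : ∀ f ∈ pathsBelow T k v, f = fun m => Vertex.up^[m] v := by
    intro f hf
    have h : ∀ m, f m = Vertex.up^[m] v ∧ T ≤ (f m).t := by
      intro m
      induction m with
      | zero => exact ⟨hf.1.1, by rw [hf.1.1]⟩
      | succ m ih =>
        rcases hf.1.2.1 m with h | h
        · have := hf.2 m h
          have := h.1
          omega
        · rw [isSouthStep_iff] at h
          rw [Function.iterate_succ_apply', ← ih.1, h]
          exact ⟨rfl, ih.2.trans (Vertex.le_up_t _)⟩
    exact funext fun m => (h m).1
  split_ifs with hik
  · refine Set.Subset.antisymm (fun f hf => key f hf) ?_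
    rintro _ rfl
    refine ⟨⟨rfl, fun m => Or.inr ?_, ?_, ?_⟩, fun m h => ?_⟩
    · exact isSouthStep_iff.2 (Function.iterate_succ_apply' _ _ _)
    · exact Eventually.of_forall fun m => (iterate_up_i v m).trans hik
    · simp only [iterate_up_y]
      refine tendsto_atTop_add_const_left _ _ ?_
      exact tendsto_natCast_atTop_atTop.atTop_mul_const (by positivity)
    · dsimp only at h
      rw [Function.iterate_succ_apply'] at h
      exact absurd h (not_isEastStep_up _)
  · refine Set.eq_empty_of_forall_notMem fun f hf => hik ?_
    obtain ⟨m, hm⟩ := hf.1.2.2.1.exists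
    rw [key f hf] at hm
    exact (iterate_up_i v m).symm.trans hm

theorem pathsBelow_finite {T : ℕ} (k : ℕ) (v : Vertex) (hv : v.t < T) :
    (pathsBelow T k v).Finite := by
  classical
  refine vertex_induction (motive := fun v => (pathsBelow T k v).Finite) (fun i => ?_)
    (fun v hv h1 h2 => ?_) v hv
  · rw [pathsBelow_top]
    split_ifs
    · exact Set.finite_singleton _
    · exact Set.finite_empty
  · rw [pathsBelow_eq hv]
    refine (h1.image _).union ?_
    split_ifs with h
    · exact (h2 h).image _
    · exact Set.finite_empty

/-! ### Weights of paths and truncated path sums -/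

variable {R : Type*} [CommRing R]

/-- The weight of a path given as a sequence of vertices. -/
def pathWeight (w : WeightSystem R) (f : ℕ → Vertex) : R :=
  ∏ᶠ (m : ℕ) (_ : IsEastStep (f (m + 1)) (f m)), w (f (m + 1)).t (f (m + 1)).i (f (m + 1)).j

open Classical in
theorem pathWeight_eq_prod (w : WeightSystem R) {f : ℕ → Vertex} {M : ℕ}
    (h : ∀ m, M ≤ m → ¬ IsEastStep (f (m + 1)) (f m)) :
    pathWeight w f = ∏ m ∈ Finset.range M, if IsEastStep (f (m + 1)) (f m) then
      w (f (m + 1)).t (f (m + 1)).i (f (m + 1)).j else 1 := by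
  have e : pathWeight w f = ∏ᶠ m : ℕ, if IsEastStep (f (m + 1)) (f m) then
      w (f (m + 1)).t (f (m + 1)).i (f (m + 1)).j else 1 :=
    finprod_congr fun m => finprod_eq_if
  rw [e]
  refine finprod_eq_prod_of_mulSupport_subset _ fun m hm => ?_
  rw [Finset.coe_range, Set.mem_Iio]
  by_contra hM
  exact hm (if_neg (h m (not_lt.1 hM)))

theorem exists_forall_not_isEastStep {k : ℕ} {v : Vertex} {f : ℕ → Vertex}
    (hf : f ∈ paths k v) : ∃ M, ∀ m, M ≤ m → ¬ IsEastStep (f (m + 1)) (f m) := by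
  obtain ⟨M, hM⟩ := eventually_atTop.1 hf.2.2.1
  refine ⟨M, fun m hm h => ?_⟩
  have h1 := hM m hm
  have h2 := hM (m + 1) (by omega)
  have := h.2.1
  omega

open Classical in
theorem pathWeight_consVertex (w : WeightSystem R) {k : ℕ} {u v : Vertex} {f : ℕ → Vertex}
    (hf : f ∈ paths k u) : pathWeight w (consVertex v f) =
      (if IsEastStep u v then w u.t u.i u.j else 1) * pathWeight w f := by
  obtain ⟨M, hM⟩ := exists_forall_not_isEastStep hf
  have hM' : ∀ m, M + 1 ≤ m → ¬ IsEastStep (consVertex v f (m + 1)) (consVertex v f m) := by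
    rintro (_ | m) hm
    · omega
    · exact hM m (by omega)
  rw [pathWeight_eq_prod w hM, pathWeight_eq_prod w hM', Finset.prod_range_succ', mul_comm]
  obtain rfl := hf.1
  rfl

/-- The sum of the weights of the paths from `(k, ∞)` to `v` with east steps below level `T`. -/
def pathSum (w : WeightSystem R) (T k : ℕ) (v : Vertex) : R :=
  ∑ᶠ f ∈ pathsBelow T k v, pathWeight w f

theorem pathSum_top (w : WeightSystem R) (T k i : ℕ) :
    pathSum w T k ⟨T, i, 0, Nat.zero_le i⟩ = if i = k then 1 else 0 := by
  rw [pathSum, pathsBelow_top]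
  split_ifs with h
  · rw [finsum_mem_singleton, pathWeight_eq_prod w (M := 0)]
    · rfl
    · intro m _
      rw [Function.iterate_succ_apply']
      exact not_isEastStep_up _
  · exact finsum_mem_empty

theorem pathsBelow_finite_up {T k : ℕ} {v : Vertex} (hv : v.t < T) :
    (pathsBelow T k v.up).Finite := by
  classical
  have h := pathsBelow_finite k v hv
  rw [pathsBelow_eq hv] at h
  exact (Set.finite_image_iff (consVertex_injective v).injOn).1 (h.subset Set.subset_union_left)

theorem pathSum_eq (w : WeightSystem R) {T : ℕ} (k : ℕ) {v : Vertex} (hv : v.t < T) :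
    pathSum w T k v = pathSum w T k v.up +
      if v.j < v.i then w v.west.t v.west.i v.west.j * pathSum w T k v.west else 0 := by
  classical
  have hup : ∑ᶠ f ∈ consVertex v '' pathsBelow T k v.up, pathWeight w f =
      pathSum w T k v.up := by
    rw [finsum_mem_image (consVertex_injective v).injOn]
    refine finsum_mem_congr rfl fun f hf => ?_
    rw [pathWeight_consVertex w hf.1, if_neg (not_isEastStep_up v), one_mul]
  rw [pathSum, pathsBelow_eq hv]
  split_ifs with h
  · have hw : (v.west).t < T := hv
    rw [finsum_mem_union, hup, finsum_mem_image (consVertex_injective v).injOn, pathSum, pathSum,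
      mul_finsum_mem' _ _ (pathsBelow_finite k _ hw)]
    · congr 1
      refine finsum_mem_congr rfl fun f hf => ?_
      rw [pathWeight_consVertex w hf.1, if_pos (isEastStep_iff.2 ⟨h, rfl⟩)]
    · rw [Set.disjoint_left]
      rintro _ ⟨f, hf, rfl⟩ ⟨g, hg, hfg⟩
      obtain rfl := consVertex_injective v hfg
      refine not_isEastStep_up v ?_
      rw [← hf.1.1, hg.1.1]
      exact isEastStep_iff.2 ⟨h, rfl⟩
    · exact (pathsBelow_finite_up hv).image _
    · exact (pathsBelow_finite k _ hw).image _
  · rw [Set.union_empty, hup, add_zero]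

theorem pathSum_self (w : WeightSystem R) {s T : ℕ} (k n : ℕ) (hs : s < T) :
    pathSum w T k ⟨s, n, n, le_rfl⟩ = pathSum w T k ⟨s + 1, n, 0, Nat.zero_le n⟩ := by
  rw [pathSum_eq w k hs, if_neg (lt_irrefl _), add_zero, Vertex.up, dif_neg (lt_irrefl _)]

theorem pathSum_succ (w : WeightSystem R) {s T : ℕ} (k n j : ℕ) (hj : j ≤ n) (hs : s < T) :
    pathSum w T k ⟨s, n + 1, j, Nat.le_succ_of_le hj⟩ =
      pathSum w T k ⟨s, n + 1, j + 1, Nat.succ_le_succ hj⟩ +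
        w s n j * pathSum w T k ⟨s, n, j, hj⟩ := by
  have e : Vertex.west ⟨s, n + 1, j, Nat.le_succ_of_le hj⟩ = ⟨s, n, j, hj⟩ :=
    Vertex.ext' rfl rfl (by simp only [Vertex.west]; omega)
  rw [pathSum_eq w k hs, if_pos (Nat.lt_succ_of_le hj), Vertex.up,
    dif_pos (Nat.lt_succ_of_le hj), e]

theorem IsChain.le {K V : Type*} [Field K] [AddCommGroup V] [Module K V] {w : WeightSystem K}
    {s T : ℕ} {S U : ℕ → V} (h : IsChain w s T S U) : s ≤ T := by
  induction h with
  | refl => exact le_rfl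
  | cons _ _ ih => omega

/-- Expansion over the paths that cross the levels of a chain. -/
theorem IsChain.eq_sum_pathSum {K V : Type*} [Field K] [AddCommGroup V] [Module K V]
    {w : WeightSystem K} {s T : ℕ} {S U : ℕ → V} (h : IsChain w s T S U) {n B : ℕ} (hn : n < B) :
    S n = ∑ k ∈ Finset.range B, pathSum w T k ⟨s, n, 0, Nat.zero_le n⟩ • U k := by
  induction h generalizing n with
  | refl t R =>
    simp only [pathSum_top, ite_smul, one_smul, zero_smul, Finset.sum_ite_eq,
      Finset.mem_range, if_pos hn]
  | @cons s T R S U hslab hc ih =>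
    obtain ⟨P, hP0, hPn, hP⟩ := hslab
    have hs : s < T := hc.le
    -- Slab values and path sums obey the same recursion, from `(n + 1, j + 1)` and `(n, j)`, with
    -- the next level as boundary on the diagonal. The bound `B` is common to all columns so that
    -- the sums can be added termwise.
    have key : ∀ n, n < B → ∀ d j (hj : j ≤ n), j + d = n →
        P n j = ∑ k ∈ Finset.range B, pathSum w T k ⟨s, n, j, hj⟩ • U k := by
      intro n
      induction n with
      | zero =>
        intro hB d j hj hd
        obtain rfl : j = 0 := by omega
        rw [hPn, ih hB]
        exact Finset.sum_congr rfl fun k _ => by rw [pathSum_self w k 0 hs]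
      | succ n ihn =>
        intro hB d
        induction d with
        | zero =>
          intro j hj hd
          obtain rfl : j = n + 1 := by omega
          rw [hPn, ih hB]
          exact Finset.sum_congr rfl fun k _ => by rw [pathSum_self w k (n + 1) hs]
        | succ d ihd =>
          intro j hj hd
          have hjn : j ≤ n := by omega
          rw [hP n j hjn, ihd (j + 1) (by omega) (by omega),
            ihn (by omega) (n - j) j hjn (by omega), Finset.smul_sum, ← Finset.sum_add_distrib]
          refine Finset.sum_congr rfl fun k _ => ?_
          rw [pathSum_succ w k n j hjn hs, add_smul, mul_smul]
    rw [← hP0]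
    exact key n hn n 0 (Nat.zero_le n) (zero_add n)

/-! ### Paths to the bottom level -/

theorem SEPath.vert_injective {k n : ℕ} :
    Function.Injective (SEPath.vert : SEPath k n → ℕ → Vertex) := by
  rintro ⟨f, _, _, _, _⟩ ⟨g, _, _, _, _⟩ h
  cases h
  rfl

theorem SEPath.vert_mem_paths {k n : ℕ} (p : SEPath k n) :
    p.vert ∈ paths k ⟨0, n, 0, Nat.zero_le n⟩ :=
  ⟨p.vert_zero, p.step, p.tendsto_fst, p.tendsto_snd⟩

theorem SEPath.finite_vert_mem {T k n : ℕ} (hT : 0 < T) :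
    {p : SEPath k n | p.vert ∈ pathsBelow T k ⟨0, n, 0, Nat.zero_le n⟩}.Finite :=
  (pathsBelow_finite k _ hT).preimage SEPath.vert_injective.injOn

/-- The finite set of paths whose east steps are all below level `T + 1`. -/
def SEPath.below (k n T : ℕ) : Finset (SEPath k n) :=
  (SEPath.finite_vert_mem (T := T + 1) (k := k) (n := n) T.succ_pos).toFinset

theorem SEPath.mem_below {k n T : ℕ} {p : SEPath k n} : p ∈ SEPath.below k n T ↔
    ∀ m, IsEastStep (p.vert (m + 1)) (p.vert m) → (p.vert (m + 1)).t < T + 1 := by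
  rw [SEPath.below, Set.Finite.mem_toFinset]
  exact ⟨fun h => h.2, fun h => ⟨p.vert_mem_paths, h⟩⟩

theorem SEPath.below_mono {k n : ℕ} : Monotone (SEPath.below k n) := fun T T' h p hp => by
  rw [SEPath.mem_below] at hp ⊢
  exact fun m hm => (hp m hm).trans_le (Nat.succ_le_succ h)

theorem SEPath.exists_mem_below {k n : ℕ} (p : SEPath k n) : ∃ T, p ∈ SEPath.below k n T := by
  obtain ⟨M, hM⟩ := exists_forall_not_isEastStep p.vert_mem_paths
  refine ⟨(Finset.range M).sup fun m => (p.vert (m + 1)).t, SEPath.mem_below.2 fun m hm => ?_⟩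
  have hmM : m < M := by
    by_contra h
    exact hM m (not_lt.1 h) hm
  exact Nat.lt_succ_of_le
    (Finset.le_sup (f := fun m => (p.vert (m + 1)).t) (Finset.mem_range.2 hmM))

theorem SEPath.sum_below (w : WeightSystem R) (k n T : ℕ) :
    ∑ p ∈ SEPath.below k n T, p.weight w = pathSum w (T + 1) k ⟨0, n, 0, Nat.zero_le n⟩ := by
  have e : pathsBelow (T + 1) k ⟨0, n, 0, Nat.zero_le n⟩ = SEPath.vert ''
      {p : SEPath k n | p.vert ∈ pathsBelow (T + 1) k ⟨0, n, 0, Nat.zero_le n⟩} := by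
    ext f
    constructor
    · intro hf
      exact ⟨⟨f, hf.1.1, hf.1.2.1, hf.1.2.2.1, hf.1.2.2.2⟩, hf, rfl⟩
    · rintro ⟨p, hp, rfl⟩
      exact hp
  rw [pathSum, e, finsum_mem_image SEPath.vert_injective.injOn,
    finsum_mem_eq_finite_toFinset_sum _ (SEPath.finite_vert_mem T.succ_pos)]
  rfl

theorem pathWeight_map {R' : Type*} [CommRing R'] (φ : R →* R') {W : WeightSystem R}
    {w : WeightSystem R'} (h : ∀ t i j, j ≤ i → φ (W t i j) = w t i j) {k : ℕ} {v : Vertex}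
    {f : ℕ → Vertex} (hf : f ∈ paths k v) : φ (pathWeight W f) = pathWeight w f := by
  obtain ⟨M, hM⟩ := exists_forall_not_isEastStep hf
  rw [pathWeight_eq_prod W hM, pathWeight_eq_prod w hM, map_prod]
  refine Finset.prod_congr rfl fun m _ => ?_
  split_ifs
  · exact h _ _ _ (f (m + 1)).hj
  · exact map_one φ

/-- Transfers truncated sums between the power series ring and its fraction field, where the chain
lives. -/
theorem pathSum_map {R' : Type*} [CommRing R'] (φ : R →+* R') {W : WeightSystem R}
    {w : WeightSystem R'} (h : ∀ t i j, j ≤ i → φ (W t i j) = w t i j) (k n T : ℕ) :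
    φ (pathSum W (T + 1) k ⟨0, n, 0, Nat.zero_le n⟩) =
      pathSum w (T + 1) k ⟨0, n, 0, Nat.zero_le n⟩ := by
  rw [← SEPath.sum_below, ← SEPath.sum_below, map_sum]
  exact Finset.sum_congr rfl fun p _ => pathWeight_map (φ : R →* R') h p.vert_mem_paths

end Paths

/-! ### Mixed moments as truncated path sums -/

section Moments

variable {K : Type*} [Field K]

theorem degree_qPochPair {a q : K} (h2 : (2 : K) ≠ 0) (hq0 : q ≠ 0) (ha : a ≠ 0) (k : ℕ) :
    (qPochPair a q k).degree = k := by
  induction k with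
  | zero => simp [qPochPair]
  | succ k ih =>
    have e : (1 - C (2 * a * q ^ k) * X + C (a ^ 2 * q ^ (2 * k)) : K[X]) =
        C (-(2 * a * q ^ k)) * X + C (1 + a ^ 2 * q ^ (2 * k)) := by
      simp only [C_neg, C_add, C_1]
      ring
    rw [qPochPair_succ, degree_mul, ih, e, degree_linear]
    · rfl
    · exact neg_ne_zero.2 (mul_ne_zero (mul_ne_zero h2 ha) (pow_ne_zero _ hq0))

theorem degree_askeyWilson {a b c d q : K} (h2 : (2 : K) ≠ 0) (hq0 : q ≠ 0)
    (hq : ∀ r : ℕ, 1 ≤ r → q ^ r ≠ 1) (ha : a ≠ 0) (hab : ∀ r : ℕ, a * b * q ^ r ≠ 1)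
    (hac : ∀ r : ℕ, a * c * q ^ r ≠ 1) (had : ∀ r : ℕ, a * d * q ^ r ≠ 1)
    (habcd : ∀ r : ℕ, a * b * c * d * q ^ r ≠ 1) (n : ℕ) :
    (askeyWilson a b c d q n).degree = n := by
  rcases n with _ | n
  · simp [askeyWilson_zero]
  rw [askeyWilson_eq_qTransform h2 hq0 hq ha hab hac had habcd, qTransform,
    Finset.Nat.sum_antidiagonal_succ']
  have hlead : qBinom q (n + 1) 0 * awKernel a b c d q (n + 1) 0 ≠ 0 := by
    rw [qBinom_zero_right hq, one_mul, awKernel]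
    simp only [qPoch_zero, mul_one]
    refine div_ne_zero (Finset.prod_ne_zero_iff.2 fun i _ => neg_ne_zero.2 ?_)
      (pow_ne_zero _ (mul_ne_zero h2 ha))
    exact pow_ne_zero _ (inv_ne_zero hq0)
  have h1 : ((qBinom q (n + 1) 0 * awKernel a b c d q (n + 1) 0) • qPochPair a q (n + 1)).degree =
      ((n + 1 : ℕ) : WithBot ℕ) := by
    rw [smul_eq_C_mul, degree_C_mul hlead, degree_qPochPair h2 hq0 ha]
  rw [degree_add_eq_left_of_degree_lt]
  · exact h1
  · dsimp only
    rw [h1]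
    refine lt_of_le_of_lt ((degree_sum_le _ _).trans (Finset.sup_le (a := (n : WithBot ℕ))
      fun x hx => ?_)) (by exact_mod_cast n.lt_succ_self)
    refine (degree_smul_le _ _).trans ?_
    rw [degree_qPochPair h2 hq0 ha]
    exact_mod_cast Finset.HasAntidiagonal.antidiagonal.fst_le hx

theorem coeff_unique {p : ℕ → K[X]} (hp : ∀ n, (p n).degree = n) {B : ℕ} {c c' : ℕ → K}
    (h : ∑ k ∈ Finset.range B, c k • p k = ∑ k ∈ Finset.range B, c' k • p k) {k : ℕ}
    (hk : k < B) : c k = c' k := by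
  have hl := (Polynomial.Sequence.mk p hp).linearIndependent
  rw [linearIndependent_iff'] at hl
  refine sub_eq_zero.1 (hl (Finset.range B) (fun k => c k - c' k) ?_ k (Finset.mem_range.2 hk))
  simp only [sub_smul, Finset.sum_sub_distrib]
  exact sub_eq_zero.2 h

theorem IsMixedMoments.sum_range {p : ℕ → K[X]} {σ : ℕ → ℕ → K} (h : IsMixedMoments p σ)
    {n B : ℕ} (hn : n < B) : (X : K[X]) ^ n = ∑ k ∈ Finset.range B, σ n k • p k := by
  rw [h.2.1 n]
  simp only [smul_eq_C_mul]
  refine Finset.sum_subset (Finset.range_mono hn) fun k _ hk => ?_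
  rw [h.2.2 n k (by simpa using hk), C_0, zero_mul]

theorem sum_qTransform (q : K) (e : ℕ → ℕ → K) {V : Type*} [AddCommGroup V] [Module K V]
    (p : ℕ → V) (z : ℕ → K) (B : ℕ) :
    ∑ m ∈ Finset.range B, z m • qTransform q e p m =
      ∑ k ∈ Finset.range B,
        (∑ l ∈ Finset.range (B - k), z (k + l) * (qBinom q k l * e k l)) • p k := by
  have := Finset.sum_range_diag_flip B fun k l => (z (k + l) * (qBinom q k l * e k l)) • p k
  simp only [Finset.sum_smul]
  rw [← this]
  refine Finset.sum_congr rfl fun m _ => ?_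
  rw [qTransform, Finset.smul_sum, Finset.Nat.sum_antidiagonal_eq_sum_range_succ_mk]
  refine Finset.sum_congr rfl fun k hk => ?_
  rw [smul_smul, Nat.add_sub_cancel' (Nat.lt_succ_iff.1 (Finset.mem_range.1 hk))]

/-- The coefficients that express the Askey–Wilson polynomials at level `7 + 8 m` of the weight
system by those at infinity. -/
def tailKernel (a b c d q : K) (m : ℕ) : ℕ → ℕ → K :=
  connKernel (fun i => 1 / 2 * (a * b * c * d * q ^ (2 * i)) ^ m * d)
    (a * b) (b * c) (a * c) (a * d) q

theorem tailKernel_zero_right (a b c d q : K) (m k : ℕ) : tailKernel a b c d q m k 0 = 1 := by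
  simp [tailKernel, connKernel, risingProd, qPoch_zero]

theorem tailKernel_eq (a b c d q : K) (m k l : ℕ) : tailKernel a b c d q m k l =
    (∏ i ∈ Finset.range l, (a * b * c * d * q ^ (2 * (k + i)))) ^ m *
      tailKernel a b c d q 0 k l := by
  have e : risingProd (fun i => 1 / 2 * (a * b * c * d * q ^ (2 * i)) ^ m * d) k l =
      (∏ i ∈ Finset.range l, (a * b * c * d * q ^ (2 * (k + i)))) ^ m *
        risingProd (fun i => 1 / 2 * (a * b * c * d * q ^ (2 * i)) ^ 0 * d) k l := by
    rw [risingProd, risingProd, ← Finset.prod_pow, ← Finset.prod_mul_distrib]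
    exact Finset.prod_congr rfl fun i _ => by ring
  rw [tailKernel, tailKernel, connKernel, connKernel, e]
  simp only [mul_assoc]

theorem X_pow_eq_sum {a b c d q : K} (h2 : (2 : K) ≠ 0) (hq0 : q ≠ 0)
    (hq : ∀ r : ℕ, 1 ≤ r → q ^ r ≠ 1) (ha : a ≠ 0) (hab : ∀ r : ℕ, a * b * q ^ r ≠ 1)
    (hac : ∀ r : ℕ, a * c * q ^ r ≠ 1) (had : ∀ r : ℕ, a * d * q ^ r ≠ 1)
    (habcd : ∀ r : ℕ, a * b * c * d * q ^ r ≠ 1) (m : ℕ) {n B : ℕ} (hn : n < B) :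
    (X : K[X]) ^ n = ∑ k ∈ Finset.range B, (∑ l ∈ Finset.range (B - k),
      pathSum (wAW a b c d q) (7 + 8 * m) (k + l) ⟨0, n, 0, Nat.zero_le n⟩ *
        (qBinom q k l * tailKernel a b c d q m k l)) • askeyWilson a b c d q k := by
  rw [← sum_qTransform q _ _
    (fun k => pathSum (wAW a b c d q) (7 + 8 * m) k ⟨0, n, 0, Nat.zero_le n⟩)]
  exact (isChain_wAW h2 hq0 hq ha hab hac had habcd m).eq_sum_pathSum hn

/-- Exact at every height: the term `l = 0` is the truncated path sum, and the others carry the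
off-diagonal tail. Only finitely many terms occur, so limits may be taken termwise. -/
theorem IsMixedMoments.eq_sum {a b c d q : K} (h2 : (2 : K) ≠ 0) (hq0 : q ≠ 0)
    (hq : ∀ r : ℕ, 1 ≤ r → q ^ r ≠ 1) (ha : a ≠ 0) (hab : ∀ r : ℕ, a * b * q ^ r ≠ 1)
    (hac : ∀ r : ℕ, a * c * q ^ r ≠ 1) (had : ∀ r : ℕ, a * d * q ^ r ≠ 1)
    (habcd : ∀ r : ℕ, a * b * c * d * q ^ r ≠ 1) {σ : ℕ → ℕ → K}
    (hσ : IsMixedMoments (askeyWilson a b c d q) σ) (m : ℕ) {n k B : ℕ} (hn : n < B)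
    (hk : k < B) : σ n k = ∑ l ∈ Finset.range (B - k),
      pathSum (wAW a b c d q) (7 + 8 * m) (k + l) ⟨0, n, 0, Nat.zero_le n⟩ *
        (qBinom q k l * tailKernel a b c d q m k l) :=
  coeff_unique (c := σ n) (c' := fun k => ∑ l ∈ Finset.range (B - k),
      pathSum (wAW a b c d q) (7 + 8 * m) (k + l) ⟨0, n, 0, Nat.zero_le n⟩ *
        (qBinom q k l * tailKernel a b c d q m k l)) hσ.1
    ((hσ.sum_range hn).symm.trans (X_pow_eq_sum h2 hq0 hq ha hab hac had habcd m hn)) hk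

theorem existsUnique_isMixedMoments {a b c d q : K} (h2 : (2 : K) ≠ 0) (hq0 : q ≠ 0)
    (hq : ∀ r : ℕ, 1 ≤ r → q ^ r ≠ 1) (ha : a ≠ 0) (hab : ∀ r : ℕ, a * b * q ^ r ≠ 1)
    (hac : ∀ r : ℕ, a * c * q ^ r ≠ 1) (had : ∀ r : ℕ, a * d * q ^ r ≠ 1)
    (habcd : ∀ r : ℕ, a * b * c * d * q ^ r ≠ 1) :
    ∃! σ : ℕ → ℕ → K, IsMixedMoments (askeyWilson a b c d q) σ := by
  -- The finite formula at `m = 0` already supplies the moments; no limit is needed for existence.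
  refine existsUnique_of_exists_of_unique ⟨fun n k => if n < k then 0 else
    ∑ l ∈ Finset.range (n + 1 - k),
      pathSum (wAW a b c d q) (7 + 8 * 0) (k + l) ⟨0, n, 0, Nat.zero_le n⟩ *
        (qBinom q k l * tailKernel a b c d q 0 k l),
    degree_askeyWilson h2 hq0 hq ha hab hac had habcd, fun n => ?_, fun n k hk => if_pos hk⟩
    fun σ τ hσ hτ => ?_
  · rw [X_pow_eq_sum h2 hq0 hq ha hab hac had habcd 0 n.lt_succ_self]
    refine Finset.sum_congr rfl fun k hk => ?_
    dsimp only
    rw [if_neg (by have := Finset.mem_range.1 hk; omega), smul_eq_C_mul]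
  · funext n k
    rw [IsMixedMoments.eq_sum h2 hq0 hq ha hab hac had habcd hσ 0
      (show n < n + k + 1 by omega) (show k < n + k + 1 by omega),
      IsMixedMoments.eq_sum h2 hq0 hq ha hab hac had habcd hτ 0
      (show n < n + k + 1 by omega) (show k < n + k + 1 by omega)]

end Moments

/-! ### Convergence in a complete normed field -/

section Numerical

theorem pathSum_nonneg {w : WeightSystem ℝ} (hw : ∀ t i j, 0 ≤ w t i j) (T k : ℕ) (v : Vertex) :
    0 ≤ pathSum w T k v := by
  refine finsum_nonneg fun f => finsum_nonneg fun _ => ?_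
  exact finprod_nonneg fun m => finprod_nonneg fun _ => hw _ _ _

/-- A bound for path sums that is independent of the level. -/
theorem exists_pathSum_le {w : WeightSystem ℝ} (hw : ∀ t i j, 0 ≤ w t i j) {g : ℕ → ℝ}
    (hg0 : ∀ t, 0 ≤ g t) {n : ℕ} (hg : ∀ t i j, i < n → j ≤ i → w t i j ≤ g t) {G : ℝ}
    (hG : ∀ T, ∑ t ∈ Finset.range T, g t ≤ G) :
    ∃ c, ∀ T k, pathSum w (T + 1) k ⟨0, n, 0, Nat.zero_le n⟩ ≤ c := by
  have hG' : ∀ s T, ∑ t ∈ Finset.Ico s T, g t ≤ G := fun s T => by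
    refine (Finset.sum_le_sum_of_subset_of_nonneg ?_ fun t _ _ => hg0 t).trans (hG T)
    intro t ht
    exact Finset.mem_range.2 (Finset.mem_Ico.1 ht).2
  have hG0 : 0 ≤ G := by simpa using hG 0
  -- `c (i + 1)` bounds every path sum in column `i`; `c 0 = 0` since nothing lies west of column 0.
  let c : ℕ → ℝ := fun i => Nat.rec 0 (fun i x => 1 + x * ((i + 1 : ℕ) * G)) i
  have hc : ∀ i, c (i + 1) = 1 + c i * ((i + 1 : ℕ) * G) := fun i => rfl
  have hc0 : ∀ i, 0 ≤ c i := fun i => by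
    induction i with
    | zero => exact le_rfl
    | succ i ih => rw [hc]; positivity
  -- The bracket is the total of `g` over the vertices of the column from `v` up to height `T`.
  -- Going up one vertex lowers it by `g v.t`, which pays for the east step entering `v`.
  have key : ∀ T k, ∀ v : Vertex, v.t < T → v.i ≤ n → pathSum w T k v ≤
      1 + c v.i * ((v.i + 1 : ℕ) * (∑ t ∈ Finset.Ico v.t T, g t) - v.j * g v.t) := by
    intro T k v hv
    refine vertex_induction (T := T) (motive := fun v => v.i ≤ n → pathSum w T k v ≤
      1 + c v.i * ((v.i + 1 : ℕ) * (∑ t ∈ Finset.Ico v.t T, g t) - v.j * g v.t))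
      (fun i _ => ?_) (fun v hv h1 h2 hvn => ?_) v hv
    · rw [pathSum_top]
      simp only [Finset.Ico_self, Finset.sum_empty, mul_zero, Nat.cast_zero, zero_mul, sub_zero,
        add_zero]
      split_ifs <;> norm_num
    · obtain ⟨t, i, j, hj⟩ := v
      have hs : ∑ t ∈ Finset.Ico t T, g t = g t + ∑ t ∈ Finset.Ico (t + 1) T, g t :=
        Finset.sum_eq_sum_Ico_succ_bot hv g
      rw [pathSum_eq w k hv]
      by_cases hji : j < i
      · rw [if_pos hji]
        obtain ⟨i, rfl⟩ : ∃ i', i = i' + 1 := ⟨i - 1, by omega⟩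
        have h1 := h1 (by rw [Vertex.up_i]; exact hvn)
        have h2 := h2 hji (by dsimp only [Vertex.west] at hvn ⊢; omega)
        rw [Vertex.up, dif_pos hji] at h1 ⊢
        dsimp only [Vertex.west] at h1 h2 hvn ⊢
        have e : i + 1 - 1 = i := rfl
        have e' : min j i = j := min_eq_left (by omega)
        simp only [e, e'] at h2 ⊢
        have hwg := hg t i j (by omega) (by omega)
        have hp := pathSum_nonneg hw T k ⟨t, i, j, by omega⟩
        have hb : pathSum w T k ⟨t, i, j, by omega⟩ ≤ c (i + 1) := by
          rw [hc]
          refine h2.trans (add_le_add_right (mul_le_mul_of_nonneg_left ?_ (hc0 i)) _)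
          have h3 : 0 ≤ (j : ℝ) * g t := mul_nonneg (Nat.cast_nonneg _) (hg0 t)
          have h4 := mul_le_mul_of_nonneg_left (hG' t T) (Nat.cast_nonneg (α := ℝ) (i + 1))
          linarith
        have hm : w t i j * pathSum w T k ⟨t, i, j, by omega⟩ ≤ g t * c (i + 1) :=
          mul_le_mul hwg hb hp (hg0 t)
        push_cast at h1 ⊢
        linarith
      · rw [if_neg hji, add_zero]
        obtain rfl : j = i := by omega
        have h1 := h1 (by rw [Vertex.up_i]; exact hvn)
        rw [Vertex.up, dif_neg hji] at h1 ⊢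
        refine h1.trans (add_le_add_right (mul_le_mul_of_nonneg_left ?_ (hc0 _)) _)
        dsimp only
        rw [hs]
        have := hg0 t
        push_cast
        linarith
  refine ⟨1 + c n * ((n + 1 : ℕ) * G), fun T k => ?_⟩
  refine (key (T + 1) k ⟨0, n, 0, Nat.zero_le n⟩ T.succ_pos le_rfl).trans
    (add_le_add_right (mul_le_mul_of_nonneg_left ?_ (hc0 _)) _)
  simp only [Nat.cast_zero, zero_mul, sub_zero]
  exact mul_le_mul_of_nonneg_left (hG' _ _) (Nat.cast_nonneg _)

theorem SEPath.tendsto_below (k n : ℕ) : Tendsto (SEPath.below k n) atTop atTop :=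
  tendsto_atTop_finset_of_monotone SEPath.below_mono SEPath.exists_mem_below

/-! ### Summability of path weights and passage to the limit -/

variable {K : Type*} [NormedField K]

/-- Any finite set of paths lies below some height, and the norm is multiplicative, so its norm sum
is at most a truncated path sum for the weights `‖w t i j‖`. These are bounded uniformly in the
height, since only the finitely many columns `i < n` are met. -/
theorem summable_weight [CompleteSpace K] {w : WeightSystem K} (hw : ∀ i j, Summable fun t => ‖w t i j‖)
    (k n : ℕ) : Summable fun p : SEPath k n => p.weight w := by
  set g : ℕ → ℝ := fun t => ∑ i ∈ Finset.range n, ∑ j ∈ Finset.range n, ‖w t i j‖ with hg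
  have hgs : Summable g := summable_sum fun i _ => summable_sum fun j _ => hw i j
  have hg0 : ∀ t, 0 ≤ g t := fun t =>
    Finset.sum_nonneg fun i _ => Finset.sum_nonneg fun j _ => norm_nonneg _
  obtain ⟨c, hc⟩ := exists_pathSum_le (w := fun t i j => ‖w t i j‖)
    (fun _ _ _ => norm_nonneg _) hg0 (n := n) (fun t i j hi hj => by
      refine le_trans ?_ (Finset.single_le_sum (f := fun i => ∑ j ∈ Finset.range n, ‖w t i j‖)
        (fun i _ => Finset.sum_nonneg fun j _ => norm_nonneg _) (Finset.mem_range.2 hi))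
      exact Finset.single_le_sum (f := fun j => ‖w t i j‖) (fun j _ => norm_nonneg _)
        (Finset.mem_range.2 (hj.trans_lt hi))) (G := ∑' t, g t)
    (fun T => hgs.sum_le_tsum _ fun t _ => hg0 t)
  refine Summable.of_norm (summable_of_sum_le (c := c) (fun _ => norm_nonneg _) fun u => ?_)
  obtain ⟨T, hT⟩ := ((SEPath.tendsto_below k n).eventually_ge_atTop u).exists
  refine (Finset.sum_le_sum_of_subset_of_nonneg hT fun _ _ _ => norm_nonneg _).trans ?_
  refine le_trans (le_of_eq ?_) (hc T k)
  rw [← SEPath.sum_below]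
  exact Finset.sum_congr rfl fun p _ => pathWeight_map
    ((normHom : K →*₀ ℝ) : K →* ℝ) (fun _ _ _ _ => rfl) p.vert_mem_paths

theorem tendsto_pathSum [CompleteSpace K] {w : WeightSystem K} (hw : ∀ i j, Summable fun t => ‖w t i j‖)
    (k n : ℕ) : Tendsto (fun T => pathSum w (T + 1) k ⟨0, n, 0, Nat.zero_le n⟩) atTop
      (nhds (h w n k)) := by
  simp only [← SEPath.sum_below]
  exact (summable_weight hw k n).hasSum.comp (SEPath.tendsto_below k n)

theorem summable_of_residues {f : ℕ → ℝ} (hf : ∀ t, 0 ≤ f t) (N : ℕ) [NeZero N]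
    (h : ∀ r < N, Summable fun m => f (N * m + r)) : Summable f := by
  rw [← (Nat.divModEquiv N).symm.summable_iff,
    summable_prod_of_nonneg (f := f ∘ (Nat.divModEquiv N).symm) fun _ => hf _]
  refine ⟨fun _ => Summable.of_finite, ?_⟩
  simp only [tsum_fintype, Function.comp_apply]
  refine summable_sum fun r _ => ?_
  simpa [Nat.divModEquiv, mul_comm] using h r r.is_lt

theorem summable_norm_wAW {a b c d q : K} (h2 : (2 : K) ≠ 0) (hq0 : q ≠ 0) (ha : a ≠ 0)
    (hnorm : ∀ r : ℕ, ‖a * b * c * d * q ^ r‖ < 1) (i j : ℕ) :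
    Summable fun t => ‖wAW a b c d q t i j‖ := by
  rw [← summable_nat_add_iff 3]
  simp only [add_comm _ 3, wAW_add_three h2]
  have hs : ∀ u : K, Summable fun m : ℕ =>
      ‖1 / 2 * (a * b * c * d * q ^ (2 * i)) ^ m * q ^ j * u‖ := fun u => by
    refine ((((summable_geometric_of_lt_one (norm_nonneg _) (hnorm (2 * i))).mul_left
      ‖(1 / 2 : K)‖).mul_right ‖q ^ j‖).mul_right ‖u‖).congr fun m => ?_
    simp only [norm_mul, norm_pow]
  refine summable_of_residues (fun _ => norm_nonneg _) 8 fun r hr => ?_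
  interval_cases r
  -- The residue 0 is geometric only after its exceptional first term is dropped.
  · rw [← summable_nat_add_iff 1]
    have e : ∀ m, 8 * (m + 1) + 0 = 8 * m + 8 := fun m => by ring
    simp only [e, wAWH_eight_mul_add_eight hq0 ha]
    exact hs _
  · simp only [(wAWH_eight_mul _ _ _).1]
    exact hs _
  · simp only [(wAWH_eight_mul _ _ _).2.1]
    exact hs _
  · simp only [(wAWH_eight_mul _ _ _).2.2.1]
    exact hs _
  · simp only [(wAWH_eight_mul _ _ _).2.2.2.1]
    exact hs _
  · simp only [(wAWH_eight_mul _ _ _).2.2.2.2.1]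
    exact hs _
  · simp only [(wAWH_eight_mul _ _ _).2.2.2.2.2.1]
    exact hs _
  · simp only [(wAWH_eight_mul _ _ _).2.2.2.2.2.2]
    exact hs _

theorem tendsto_tailKernel {a b c d q : K} (hnorm : ∀ r : ℕ, ‖a * b * c * d * q ^ r‖ < 1)
    (k l : ℕ) : Tendsto (fun m => tailKernel a b c d q m k l) atTop
      (nhds (if l = 0 then 1 else 0)) := by
  rcases l with _ | l
  · simp [tailKernel_zero_right]
  · rw [funext fun m => tailKernel_eq a b c d q m k (l + 1), if_neg l.succ_ne_zero,
      ← zero_mul (tailKernel a b c d q 0 k (l + 1))]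
    refine (tendsto_pow_atTop_nhds_zero_of_norm_lt_one ?_).mul_const _
    -- For `l ≥ 1` there is at least one factor, of norm below 1, and the kernel contains the `m`-th
    -- power of this product.
    rw [norm_prod, Finset.prod_range_succ]
    exact mul_lt_one_of_nonneg_of_lt_one_right
      (Finset.prod_le_one (fun _ _ => norm_nonneg _) fun i _ => (hnorm _).le)
      (norm_nonneg _) (hnorm _)

theorem h_wAW_eq [CompleteSpace K] {a b c d q : K} (h2 : (2 : K) ≠ 0) (hq0 : q ≠ 0)
    (hq : ∀ r : ℕ, 1 ≤ r → q ^ r ≠ 1) (ha : a ≠ 0) (hab : ∀ r : ℕ, a * b * q ^ r ≠ 1)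
    (hac : ∀ r : ℕ, a * c * q ^ r ≠ 1) (had : ∀ r : ℕ, a * d * q ^ r ≠ 1)
    (hnorm : ∀ r : ℕ, ‖a * b * c * d * q ^ r‖ < 1) {σ : ℕ → ℕ → K}
    (hσ : IsMixedMoments (askeyWilson a b c d q) σ) (n k : ℕ) :
    h (wAW a b c d q) n k = σ n k := by
  have habcd : ∀ r : ℕ, a * b * c * d * q ^ r ≠ 1 := fun r hr => by
    have := hnorm r
    rw [hr, norm_one] at this
    exact lt_irrefl _ this
  -- The finite formula is constant in `m`. Its truncated sums converge to `h` and its kernels to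
  -- the identity, so in the limit only `l = 0` survives. The bound `n + k + 1` exceeds both
  -- indices, which also covers `k > n`.
  have hw := summable_norm_wAW h2 hq0 ha hnorm
  set B := n + k + 1 with hB
  have hT : Tendsto (fun m : ℕ => 6 + 8 * m) atTop atTop :=
    tendsto_atTop_mono (fun m => by dsimp only [id]; omega) tendsto_id
  have hlim : Tendsto (fun m => ∑ l ∈ Finset.range (B - k),
      pathSum (wAW a b c d q) (7 + 8 * m) (k + l) ⟨0, n, 0, Nat.zero_le n⟩ *
        (qBinom q k l * tailKernel a b c d q m k l)) atTop
      (nhds (∑ l ∈ Finset.range (B - k), h (wAW a b c d q) n (k + l) *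
        (qBinom q k l * if l = 0 then 1 else 0))) := by
    refine tendsto_finsetSum _ fun l _ => Tendsto.mul ?_
      ((tendsto_tailKernel hnorm k l).const_mul _)
    have := (tendsto_pathSum hw (k + l) n).comp hT
    refine this.congr fun m => ?_
    rw [Function.comp_apply, show 6 + 8 * m + 1 = 7 + 8 * m by ring]
  have hval : ∑ l ∈ Finset.range (B - k), h (wAW a b c d q) n (k + l) *
        (qBinom q k l * if l = 0 then 1 else 0) = h (wAW a b c d q) n k := by
    rw [Finset.sum_eq_single 0]
    · simp [qBinom_zero_right hq]
    · intro l _ hl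
      simp [hl]
    · intro h0
      exact absurd (Finset.mem_range.2 (by omega)) h0
  rw [hval] at hlim
  refine tendsto_nhds_unique hlim (tendsto_const_nhds.congr fun m => ?_)
  exact IsMixedMoments.eq_sum h2 hq0 hq ha hab hac had habcd hσ m (by omega) (by omega)

end Numerical

/-! ### Formal parameters -/

section Formal

variable {F : Type*} [Field F]

/-- The embedding of the power series into their field of fractions. -/
abbrev toFrac (F : Type*) [Field F] :
    MvPowerSeries (Fin 4) F →+* FractionRing (MvPowerSeries (Fin 4) F) :=
  algebraMap (MvPowerSeries (Fin 4) F) (FractionRing (MvPowerSeries (Fin 4) F))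

/-- The embedding of the scalars into the field of fractions of the power series. -/
abbrev scalarHom (F : Type*) [Field F] : F →+* FractionRing (MvPowerSeries (Fin 4) F) :=
  (toFrac F).comp MvPowerSeries.C

theorem scalar_eq (q : F) : scalar q = scalarHom F q := rfl

theorem toFrac_injective : Function.Injective (toFrac F) :=
  IsFractionRing.injective _ _

theorem toFrac_ne_one {x : MvPowerSeries (Fin 4) F} (hx : MvPowerSeries.constantCoeff x = 0) :
    toFrac F x ≠ 1 := fun h => by
  have : x = 1 := toFrac_injective (by rw [h, map_one])
  rw [this, map_one] at hx
  exact one_ne_zero hx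

theorem two_ne_zero_frac (h2 : (2 : F) ≠ 0) :
    (2 : FractionRing (MvPowerSeries (Fin 4) F)) ≠ 0 := by
  rw [← map_ofNat (scalarHom F) 2]
  exact (_root_.map_ne_zero (scalarHom F)).2 h2

theorem scalar_ne_zero {q : F} (hq0 : q ≠ 0) : scalar q ≠ 0 :=
  (_root_.map_ne_zero (scalarHom F)).2 hq0

theorem scalar_pow_ne_one {q : F} (hq : ∀ r : ℕ, 1 ≤ r → q ^ r ≠ 1) (r : ℕ) (hr : 1 ≤ r) :
    scalar q ^ r ≠ 1 := fun h => hq r hr <| (scalarHom F).injective <| by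
  rw [map_pow, map_one]; exact h

theorem param_ne_zero (r : Fin 4) : param F r ≠ 0 := fun h => by
  have : (MvPowerSeries.X r : MvPowerSeries (Fin 4) F) = 0 :=
    toFrac_injective (by rw [map_zero]; exact h)
  have h1 := MvPowerSeries.coeff_index_single_self_X (R := F) r
  rw [this, map_zero] at h1
  exact zero_ne_one h1

theorem param_mul_ne_one (q : F) (x : FractionRing (MvPowerSeries (Fin 4) F))
    (hx : x ∈ (toFrac F).range) (r : ℕ) : param F 0 * x * scalar q ^ r ≠ 1 := by
  obtain ⟨y, rfl⟩ := hx
  have : param F 0 * toFrac F y * scalar q ^ r =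
      toFrac F (MvPowerSeries.X 0 * y * MvPowerSeries.C q ^ r) := by
    simp [param, scalar]
  rw [this]
  exact toFrac_ne_one (by simp)

theorem param_mem_range (r : Fin 4) : param F r ∈ (toFrac F).range := ⟨_, rfl⟩

theorem scalarHom_mem_range (q : F) : scalarHom F q ∈ (toFrac F).range := ⟨_, rfl⟩

theorem map_qPoch {R R' : Type*} [CommRing R] [CommRing R'] (φ : R →+* R') (x q : R) (n : ℕ) :
    φ (qPoch x q n) = qPoch (φ x) (φ q) n := by
  simp [qPoch]

theorem qPoch_mem {R : Type*} [CommRing R] {S : Subring R} {x q : R} (hx : x ∈ S) (hq : q ∈ S)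
    (n : ℕ) : qPoch x q n ∈ S :=
  prod_mem fun _ _ => sub_mem (one_mem S) (mul_mem hx (pow_mem hq _))

/-- All factors have constant term 1, so the product is already a unit among power series. -/
theorem inv_qPoch_mem_range {x y : MvPowerSeries (Fin 4) F}
    (hx : MvPowerSeries.constantCoeff x = 0) (n : ℕ) :
    (qPoch (toFrac F x) (toFrac F y) n)⁻¹ ∈ (toFrac F).range := by
  rw [← map_qPoch]
  have hu : IsUnit (qPoch x y n) := by
    rw [MvPowerSeries.isUnit_iff_constantCoeff, map_qPoch, hx, qPoch_zero_left]
    exact isUnit_one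
  obtain ⟨u, hu⟩ := hu
  refine ⟨(u⁻¹ : (MvPowerSeries (Fin 4) F)ˣ), eq_inv_of_mul_eq_one_left ?_⟩
  rw [← hu, ← map_mul, Units.inv_mul, map_one]

theorem qBinom_mem_range (q : F) (k l : ℕ) : qBinom (scalar q) k l ∈ (toFrac F).range := by
  have : qBinom (scalar q) k l = scalarHom F (qBinom q k l) := by
    simp only [qBinom, map_div₀, map_mul, map_qPoch, scalar_eq]
  rw [this]
  exact scalarHom_mem_range _

theorem half_eq : (1 / 2 : FractionRing (MvPowerSeries (Fin 4) F)) = scalarHom F (1 / 2) := by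
  rw [map_div₀, map_one, map_ofNat]

/-- Elements of the fraction field that are power series divisible by `b ^ m`. -/
def IsMultiple (F : Type*) [Field F] (m : ℕ) (x : FractionRing (MvPowerSeries (Fin 4) F)) : Prop :=
  ∃ W : MvPowerSeries (Fin 4) F, MvPowerSeries.X 1 ^ m ∣ W ∧ toFrac F W = x

theorem IsMultiple.mul {m l : ℕ} {x y : FractionRing (MvPowerSeries (Fin 4) F)}
    (hx : IsMultiple F m x) (hy : IsMultiple F l y) : IsMultiple F (m + l) (x * y) := by
  obtain ⟨V, hV, rfl⟩ := hx
  obtain ⟨W, hW, rfl⟩ := hy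
  exact ⟨V * W, by rw [pow_add]; exact mul_dvd_mul hV hW, map_mul _ _ _⟩

theorem isMultiple_zero_iff {x : FractionRing (MvPowerSeries (Fin 4) F)} :
    IsMultiple F 0 x ↔ x ∈ (toFrac F).range := by
  simp [IsMultiple, RingHom.mem_range]

theorem isMultiple_param_one : IsMultiple F 1 (param F 1) :=
  ⟨MvPowerSeries.X 1, by rw [pow_one], rfl⟩

theorem IsMultiple.mul_range {m : ℕ} {x y : FractionRing (MvPowerSeries (Fin 4) F)}
    (hx : IsMultiple F m x) (hy : y ∈ (toFrac F).range) : IsMultiple F m (x * y) :=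
  hx.mul (isMultiple_zero_iff.2 hy)

theorem IsMultiple.pow {x : FractionRing (MvPowerSeries (Fin 4) F)}
    (hx : IsMultiple F 1 x) (m : ℕ) : IsMultiple F m (x ^ m) := by
  obtain ⟨V, hV, rfl⟩ := hx
  rw [pow_one] at hV
  exact ⟨V ^ m, pow_dvd_pow_of_dvd hV m, map_pow _ _ _⟩

theorem isMultiple_params {x : FractionRing (MvPowerSeries (Fin 4) F)}
    (hx : x ∈ (toFrac F).range) :
    IsMultiple F 1 (param F 0 * param F 1 * param F 2 * param F 3 * x) := by
  have : param F 0 * param F 1 * param F 2 * param F 3 * x =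
      param F 1 * (param F 0 * param F 2 * param F 3 * x) := by ring
  rw [this]
  exact isMultiple_param_one.mul_range (mul_mem (mul_mem (mul_mem (param_mem_range _)
    (param_mem_range _)) (param_mem_range _)) hx)

/-- Period `m` carries `(abcd)^m`. At residue 0 the inverse of `a` removes one `a` but no `b`, so
`b` measures the height without exception. -/
theorem exists_wAW_eq_pow_mul {K : Type*} [Field K] {S : Subring K} {a b c d q : K}
    (h2 : (2 : K) ≠ 0) (hS : (1 / 2 : K) ∈ S) (hq0 : q ≠ 0) (hq : q ∈ S) (hq' : q⁻¹ ∈ S)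
    (ha0 : a ≠ 0) (ha : a ∈ S) (hb : b ∈ S) (hc : c ∈ S) (hd : d ∈ S) (t i j : ℕ) :
    ∃ x ∈ S, wAW a b c d q t i j = b ^ ((t - 3) / 8) * x := by
  have hz : ∀ n : ℤ, q ^ n ∈ S := fun n => by
    obtain ⟨n, rfl | rfl⟩ := n.eq_nat_or_neg
    · rw [zpow_natCast]; exact pow_mem hq n
    · rw [zpow_neg, zpow_natCast, ← inv_pow]; exact pow_mem hq' n
  by_cases ht : t < 3
  · refine ⟨wH q t i j, ?_, by rw [wAW_eq_wH h2 ht, show (t - 3) / 8 = 0 by omega, pow_zero,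
      one_mul]⟩
    have hS' : ∀ x ∈ S, x / 2 ∈ S := fun x hx => by
      rw [← mul_one_div]; exact mul_mem hx hS
    interval_cases t
    · exact hS' _ (add_mem (hz _) (hz _))
    · exact hS' _ (neg_mem (hz _))
    · exact hS' _ (neg_mem (hz _))
  obtain ⟨s, rfl⟩ := Nat.exists_eq_add_of_le (not_lt.1 ht)
  rw [wAW_add_three h2, Nat.add_sub_cancel_left]
  obtain ⟨m, r, hr, rfl⟩ : ∃ m r, r < 8 ∧ s = 8 * m + r := ⟨s / 8, s % 8, by omega, by omega⟩
  rw [show (8 * m + r) / 8 = m by omega]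
  have hQ : ∀ r : ℕ, q ^ r ∈ S := fun r => pow_mem hq r
  have key : ∀ m u, u ∈ S → ∃ x ∈ S,
      1 / 2 * (a * b * c * d * q ^ (2 * i)) ^ m * q ^ j * u = b ^ m * x := fun m u hu =>
    ⟨1 / 2 * (a * c * d * q ^ (2 * i)) ^ m * q ^ j * u,
      mul_mem (mul_mem (mul_mem hS (pow_mem (mul_mem (mul_mem (mul_mem ha hc) hd) (hQ _)) m))
        (hQ j)) hu, by ring⟩
  interval_cases r
  · rcases m with _ | m
    · exact ⟨1 / 2 * q ^ j * a, mul_mem (mul_mem hS (hQ j)) ha, by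
        rw [mul_zero, add_zero, wAWH_zero, pow_zero, one_mul]⟩
    · obtain ⟨x, hx, h⟩ := key m _ (mul_mem (neg_mem (mul_mem hc hd)) (hQ i))
      refine ⟨x, hx, ?_⟩
      rw [show 8 * (m + 1) + 0 = 8 * m + 8 by ring, wAWH_eight_mul_add_eight hq0 ha0, pow_succ]
      linear_combination b * h
  · rw [(wAWH_eight_mul _ _ _).1]
    exact key m _ hb
  · rw [(wAWH_eight_mul _ _ _).2.1]
    exact key m _ hc
  · rw [(wAWH_eight_mul _ _ _).2.2.1]
    exact key m _ (mul_mem (neg_mem (mul_mem (mul_mem ha hb) hc)) (hQ i))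
  · rw [(wAWH_eight_mul _ _ _).2.2.2.1]
    exact key m _ hd
  · rw [(wAWH_eight_mul _ _ _).2.2.2.2.1]
    exact key m _ (mul_mem (neg_mem (mul_mem (mul_mem ha hb) hd)) (hQ i))
  · rw [(wAWH_eight_mul _ _ _).2.2.2.2.2.1]
    exact key m _ (mul_mem (neg_mem (mul_mem (mul_mem ha hc) hd)) (hQ i))
  · rw [(wAWH_eight_mul _ _ _).2.2.2.2.2.2]
    exact key m _ (mul_mem (mul_mem (mul_mem (mul_mem (pow_mem ha 2) hb) hc) hd) (hQ _))

theorem isMultiple_wAW {q : F} (h2 : (2 : F) ≠ 0) (hq0 : q ≠ 0) (t i j : ℕ) :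
    IsMultiple F ((t - 3) / 8)
      (wAW (param F 0) (param F 1) (param F 2) (param F 3) (scalar q) t i j) := by
  have hinv : (scalar q)⁻¹ ∈ (toFrac F).range := by
    rw [scalar_eq, ← map_inv₀]; exact scalarHom_mem_range _
  have hhalf : (1 / 2 : FractionRing (MvPowerSeries (Fin 4) F)) ∈ (toFrac F).range := by
    rw [half_eq]; exact scalarHom_mem_range _
  obtain ⟨x, hx, h⟩ := exists_wAW_eq_pow_mul (two_ne_zero_frac h2) hhalf (scalar_ne_zero hq0)
    (scalarHom_mem_range q) hinv (param_ne_zero 0) (param_mem_range 0) (param_mem_range 1)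
    (param_mem_range 2) (param_mem_range 3) t i j
  rw [h]
  exact (isMultiple_param_one.pow _).mul_range hx

theorem div_mem_range {x y : FractionRing (MvPowerSeries (Fin 4) F)} (hx : x ∈ (toFrac F).range)
    (hy : y⁻¹ ∈ (toFrac F).range) : x / y ∈ (toFrac F).range := by
  rw [div_eq_mul_inv]
  exact mul_mem hx hy

theorem isMultiple_tailKernel (q : F) (m k l : ℕ) :
    IsMultiple F m
      (tailKernel (param F 0) (param F 1) (param F 2) (param F 3) (scalar q) m k (l + 1)) := by
  have hQ : ∀ r : ℕ, scalar q ^ r ∈ (toFrac F).range := fun r =>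
    pow_mem (scalarHom_mem_range q) r
  have hQ1 : scalar q ∈ (toFrac F).range := scalarHom_mem_range q
  have hp := fun r => param_mem_range (F := F) r
  rw [tailKernel_eq]
  refine (IsMultiple.pow ?_ m).mul_range ?_
  · rw [Finset.prod_range_succ, mul_comm]
    refine (isMultiple_params (hQ _)).mul_range (prod_mem fun i _ => ?_)
    exact mul_mem (mul_mem (mul_mem (mul_mem (hp 0) (hp 1)) (hp 2)) (hp 3)) (hQ _)
  · rw [tailKernel, connKernel]
    refine mul_mem (mul_mem (mul_mem (prod_mem fun i _ => ?_) ?_) ?_) (div_mem_range ?_ ?_)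
    · dsimp only
      rw [half_eq, pow_zero, mul_one]
      exact mul_mem (scalarHom_mem_range _) (hp 3)
    · exact qPoch_mem (mul_mem (mul_mem (hp 0) (hp 1)) (hQ _)) hQ1 _
    · exact qPoch_mem (mul_mem (mul_mem (hp 0) (hp 2)) (hQ _)) hQ1 _
    · exact qPoch_mem (mul_mem (mul_mem (hp 1) (hp 2)) (hQ _)) hQ1 _
    · have e : param F 1 * param F 2 * (param F 0 * param F 3) * scalar q ^ (2 * k) =
          toFrac F (MvPowerSeries.X 1 * MvPowerSeries.X 2 *
            (MvPowerSeries.X 0 * MvPowerSeries.X 3) * MvPowerSeries.C q ^ (2 * k)) := by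
        simp [param, scalar]
      rw [e]
      exact inv_qPoch_mem_range (by simp) _

/-- A path outside the truncation has an east step at height at least `T + 1`, and one divisible
factor suffices. -/
theorem X_pow_dvd_weight {m T k n : ℕ} {W : WeightSystem (MvPowerSeries (Fin 4) F)}
    (hW : ∀ t i j, T + 1 ≤ t → MvPowerSeries.X 1 ^ m ∣ W t i j) {p : SEPath k n}
    (hp : p ∉ SEPath.below k n T) : MvPowerSeries.X 1 ^ m ∣ p.weight W := by
  classical
  rw [SEPath.mem_below] at hp
  push Not at hp
  obtain ⟨r, hr, hrT⟩ := hp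
  obtain ⟨M, hM⟩ := exists_forall_not_isEastStep p.vert_mem_paths
  have hrM : r < M := by
    by_contra h
    exact hM r (not_lt.1 h) hr
  change _ ∣ pathWeight W p.vert
  rw [pathWeight_eq_prod W hM]
  refine dvd_trans ?_ (Finset.dvd_prod_of_mem _ (Finset.mem_range.2 hrM))
  rw [if_pos hr]
  exact hW _ _ _ hrT

theorem coeff_eq_zero_of_X_pow_dvd {m : ℕ} {x : MvPowerSeries (Fin 4) F} {e : Fin 4 →₀ ℕ}
    (h : MvPowerSeries.X 1 ^ m ∣ x) (he : e 1 < m) : MvPowerSeries.coeff e x = 0 :=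
  MvPowerSeries.X_pow_dvd_iff.1 h e he

theorem formalPathSumEq_wAW {q : F} (h2 : (2 : F) ≠ 0) (hq0 : q ≠ 0)
    (hq : ∀ r : ℕ, 1 ≤ r → q ^ r ≠ 1)
    {σ : ℕ → ℕ → FractionRing (MvPowerSeries (Fin 4) F)}
    (hσ : IsMixedMoments
      (askeyWilson (param F 0) (param F 1) (param F 2) (param F 3) (scalar q)) σ) (n k : ℕ) :
    FormalPathSumEq (wAW (param F 0) (param F 1) (param F 2) (param F 3) (scalar q)) n k
      (σ n k) := by
  choose W hWdvd hW using fun t i j => isMultiple_wAW h2 hq0 t i j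
  set v : Vertex := ⟨0, n, 0, Nat.zero_le n⟩ with hv
  have hpm : ∀ m k, toFrac F (pathSum W (7 + 8 * m) k v) =
      pathSum (wAW (param F 0) (param F 1) (param F 2) (param F 3) (scalar q)) (7 + 8 * m) k v :=
    fun m k => by
      rw [show 7 + 8 * m = 6 + 8 * m + 1 by ring]
      exact pathSum_map (toFrac F) (fun t i j _ => hW t i j) k n _
  have hp := fun r => param_mem_range (F := F) r
  -- For each `m`, the finite formula expresses the moment as a power series congruent to the
  -- truncated path sum modulo `b ^ m`. Injectivity of `toFrac` later identifies these series for
  -- different `m`.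
  have hs : ∀ m, ∃ s, toFrac F s = σ n k ∧
      MvPowerSeries.X 1 ^ m ∣ s - pathSum W (7 + 8 * m) k v := by
    intro m
    have hE : ∀ l, ∃ E : MvPowerSeries (Fin 4) F, MvPowerSeries.X 1 ^ m ∣ E ∧ toFrac F E =
        qBinom (scalar q) k (l + 1) *
          tailKernel (param F 0) (param F 1) (param F 2) (param F 3) (scalar q) m k (l + 1) :=
      fun l => by
        rw [mul_comm]
        exact (isMultiple_tailKernel q m k l).mul_range (qBinom_mem_range _ _ _)
    choose E hEdvd hE using hE
    refine ⟨pathSum W (7 + 8 * m) k v + ∑ l ∈ Finset.range n,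
      pathSum W (7 + 8 * m) (k + (l + 1)) v * E l, ?_, ?_⟩
    · have habcd : ∀ r : ℕ, param F 0 * param F 1 * param F 2 * param F 3 * scalar q ^ r ≠ 1 :=
        fun r => by
          rw [mul_assoc (param F 0), mul_assoc (param F 0)]
          exact param_mul_ne_one q _ (mul_mem (mul_mem (hp 1) (hp 2)) (hp 3)) r
      rw [IsMixedMoments.eq_sum (two_ne_zero_frac h2) (scalar_ne_zero hq0) (scalar_pow_ne_one hq)
        (param_ne_zero 0) (param_mul_ne_one q _ (hp 1)) (param_mul_ne_one q _ (hp 2))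
        (param_mul_ne_one q _ (hp 3)) habcd hσ m (show n < n + k + 1 by omega)
        (show k < n + k + 1 by omega), show n + k + 1 - k = n + 1 by omega,
        Finset.sum_range_succ', add_zero, tailKernel_zero_right,
        qBinom_zero_right (scalar_pow_ne_one hq), mul_one, mul_one, map_add, map_sum, hpm, add_comm]
      congr 1
      refine Finset.sum_congr rfl fun l _ => ?_
      rw [map_mul, hpm, hE]
    · rw [add_sub_cancel_left]
      exact Finset.dvd_sum fun l _ => (hEdvd l).mul_left _
  obtain ⟨s, hs0, -⟩ := hs 0
  refine ⟨W, s, fun t i j _ => hW t i j, fun e => ?_, hs0⟩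
  -- One more than the exponent of `b` in the monomial: neither the tail nor a path with an east
  -- step at height `7 + 8 * (e 1 + 1)` or above can contribute to this coefficient.
  obtain ⟨s', hs', hdvd⟩ := hs (e 1 + 1)
  obtain rfl : s' = s := toFrac_injective (hs'.trans hs0.symm)
  have hbelow : ∀ p : SEPath k n, p ∉ SEPath.below k n (6 + 8 * (e 1 + 1)) →
      MvPowerSeries.coeff e (p.weight W) = 0 := fun p hp =>
    coeff_eq_zero_of_X_pow_dvd (X_pow_dvd_weight (m := e 1 + 1)
      (fun t i j ht => (pow_dvd_pow _ (by omega)).trans (hWdvd t i j)) hp) (Nat.lt_succ_self _)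
  refine ⟨(SEPath.below k n (6 + 8 * (e 1 + 1))).finite_toSet.subset fun p hp => ?_, ?_⟩
  · by_contra h
    exact hp (hbelow p h)
  · have h0 := coeff_eq_zero_of_X_pow_dvd hdvd (Nat.lt_succ_self _)
    rw [map_sub, sub_eq_zero] at h0
    rw [h0, show 7 + 8 * (e 1 + 1) = 6 + 8 * (e 1 + 1) + 1 by ring, hv, ← SEPath.sum_below,
      map_sum, finsum_eq_sum_of_support_subset]
    intro p hp
    by_contra h
    exact hp (hbelow p h)

end Formal

end LectureHall

end

theorem mainTheorem5 :
    -- numerical parameters in a complete normed field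
    (∀ (K : Type*) [NormedField K] [CompleteSpace K] (a b c d q : K),
      (2 : K) ≠ 0 → q ≠ 0 → (∀ r : ℕ, 1 ≤ r → q ^ r ≠ 1) → a ≠ 0 →
      (∀ r : ℕ, a * b * q ^ r ≠ 1) → (∀ r : ℕ, a * c * q ^ r ≠ 1) →
      (∀ r : ℕ, a * d * q ^ r ≠ 1) → (∀ r : ℕ, ‖a * b * c * d * q ^ r‖ < 1) →
      LectureHall.height (LectureHall.wH q) = 3 ∧
      (∃! σ : ℕ → ℕ → K,
        LectureHall.IsMixedMoments (LectureHall.askeyWilson a b c d q) σ) ∧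
      ∀ σ : ℕ → ℕ → K, LectureHall.IsMixedMoments (LectureHall.askeyWilson a b c d q) σ →
        ∀ n k : ℕ,
          Summable (fun p : LectureHall.SEPath k n =>
            p.weight (LectureHall.wAW a b c d q)) ∧
          LectureHall.h (LectureHall.wAW a b c d q) n k = σ n k) ∧
    -- `a, b, c, d` independent variables, formal power series
    (∀ (F : Type*) [Field F] (q : F),
      (2 : F) ≠ 0 → q ≠ 0 → (∀ r : ℕ, 1 ≤ r → q ^ r ≠ 1) →
      LectureHall.height (LectureHall.wH (LectureHall.scalar q)) = 3 ∧
      (∃! σ : ℕ → ℕ → FractionRing (MvPowerSeries (Fin 4) F),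
        LectureHall.IsMixedMoments
          (LectureHall.askeyWilson (LectureHall.param F 0) (LectureHall.param F 1)
            (LectureHall.param F 2) (LectureHall.param F 3) (LectureHall.scalar q)) σ) ∧
      ∀ σ : ℕ → ℕ → FractionRing (MvPowerSeries (Fin 4) F),
        LectureHall.IsMixedMoments
          (LectureHall.askeyWilson (LectureHall.param F 0) (LectureHall.param F 1)
            (LectureHall.param F 2) (LectureHall.param F 3) (LectureHall.scalar q)) σ →
        ∀ n k : ℕ, LectureHall.FormalPathSumEq
          (LectureHall.wAW (LectureHall.param F 0) (LectureHall.param F 1)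
            (LectureHall.param F 2) (LectureHall.param F 3) (LectureHall.scalar q))
          n k (σ n k)) := by
  refine ⟨?_, ?_⟩
  · intro K _ _ a b c d q h2 hq0 hq ha hab hac had hnorm
    have habcd : ∀ r : ℕ, a * b * c * d * q ^ r ≠ 1 := fun r hr => by
      have := hnorm r
      rw [hr, norm_one] at this
      exact lt_irrefl _ this
    exact ⟨LectureHall.height_wH h2,
      LectureHall.existsUnique_isMixedMoments h2 hq0 hq ha hab hac had habcd,
      fun σ hσ n k => ⟨LectureHall.summable_weight
        (LectureHall.summable_norm_wAW h2 hq0 ha hnorm) k n,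
        LectureHall.h_wAW_eq h2 hq0 hq ha hab hac had hnorm hσ n k⟩⟩
  · intro F _ q h2 hq0 hq
    have hp := fun r => LectureHall.param_mem_range (F := F) r
    have habcd : ∀ r : ℕ, LectureHall.param F 0 * LectureHall.param F 1 * LectureHall.param F 2 *
        LectureHall.param F 3 * LectureHall.scalar q ^ r ≠ 1 := fun r => by
      rw [mul_assoc (LectureHall.param F 0), mul_assoc (LectureHall.param F 0)]
      exact LectureHall.param_mul_ne_one q _ (mul_mem (mul_mem (hp 1) (hp 2)) (hp 3)) r
    exact ⟨LectureHall.height_wH (LectureHall.two_ne_zero_frac h2),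
      LectureHall.existsUnique_isMixedMoments (LectureHall.two_ne_zero_frac h2)
        (LectureHall.scalar_ne_zero hq0) (LectureHall.scalar_pow_ne_one hq)
        (LectureHall.param_ne_zero 0) (LectureHall.param_mul_ne_one q _ (hp 1))
        (LectureHall.param_mul_ne_one q _ (hp 2)) (LectureHall.param_mul_ne_one q _ (hp 3)) habcd,
      fun σ hσ n k => LectureHall.formalPathSumEq_wAW h2 hq0 hq hσ n k⟩
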